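/- Conventions. An action of a group $\Gamma$ by homeomorphisms on a compact metrizable space $M$ is a convergence action if every sequence of pairwise distinct elements of $\Gamma$ has a subsequence $(\gamma_n)$ for which there are points $\xi,\eta\in M$ (possibly equal) such that, for every compact $K\subset M\setminus\{\eta\}$, the sets $\gamma_nK$ converge uniformly to $\xi$. The limit set $\Lambda(H)\subset M$ of a subgroup $H\le\Gamma$ is the set of all points $\xi$ arising in this way from sequences of pairwise distinct elements of $H$ (so $\Lambda(H)=\emptyset$ if $H$ is finite). The action is non-elementary if $|\Lambda(\Gamma)|>2$. A group is a (non-elementary) convergence group if it admits a (non-elementary) convergence action on some compact metrizable space. A subgroup $H\le\Gamma$ is dynamically quasi-convex if for all disjoint closed $K,L\subset M$ only finitely many cosets $gH\in\Gamma/H$ satisfy $g\Lambda(H)\cap K\ne\emptyset$ and $g\Lambda(H)\cap L\neq\emptyset$. It is dynamically malnormal if $g\Lambda(H)\cap\Lambda(H)=\emptyset$ for all $g\in\Gamma\setminus H$. A family $(H_i)_{i\in I}$ of subgroups is dynamically malnormal if every $H_i$ is dynamically malnormal and, for all $g\in\Gamma$ and $i,j\in I$, $g\Lambda(H_i)\cap\Lambda(H_j)=\emptyset$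 unless $i=j$ and $g\in H_i$. Theorem. Let $\mathcal G$ be a graph of groups over a finite connected graph, with countable vertex groups $\Gamma_v$ and infinite edge groups $\Gamma_e$, and for each vertex $v$ let a convergence action of $\Gamma_v$ on a compact metrizable space $X_v$ be given. For an end $i$ of an edge $e$ at the vertex $v$ (a loop has two ends at its vertex) let $\Gamma_i\le\Gamma_v$ be the corresponding image of $\Gamma_e$, and let $H_i=\mathrm{Stab}_{\Gamma_v}(\Lambda(\Gamma_i))$, where $\Lambda(\Gamma_i)\subset X_v$. Assume that for every vertex $v$ all the subgroups $H_i$ are dynamically quasi-convex in $\Gamma_v$, and that the family $(H_i)_i$, indexed by the edge ends $i$ at $v$, is dynamically malnormal in $\Gamma_v$. Then the fundamental group $\Gamma=\pi_1(\mathcal G)$ is a convergence group. Moreover, $\Gamma$ is a non-elementary convergence group as soon as there is a vertex $v$ such that the action of $\Gamma_v$ on $X_v$ is non-elementary and $H_i\ne\Gamma_v$ for every edge end $i$ at $v$. -/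

import Mathlib

open Filter Topology
open scoped Pointwise

universe u

/-! ## Convergence actions -/

section Convergence

/-- `g n` converges to `ξ` locally uniformly on `M \ {η}`: for each compact `K` avoiding `η`, the
translates `g n • K` converge uniformly to the point `ξ`. -/
def ConvergesAway {Γ M : Type*} [Group Γ] [TopologicalSpace M] [MulAction Γ M]
    (g : ℕ → Γ) (ξ η : M) : Prop :=
  ∀ K : Set M, IsCompact K → η ∉ K → ∀ U ∈ 𝓝 ξ, ∀ᶠ n in atTop, ∀ x ∈ K, g n • x ∈ U

/-- `Γ` acts on `M` by homeomorphisms, and every sequence of pairwise distinct elements of `Γ` has a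
subsequence converging to a point `ξ` locally uniformly away from a point `η`. -/
structure IsConvergenceAction (Γ M : Type*) [Group Γ] [TopologicalSpace M] [MulAction Γ M] :
    Prop where
  continuous_smul : ∀ γ : Γ, Continuous fun x : M => γ • x
  exists_subseq : ∀ g : ℕ → Γ, Function.Injective g →
    ∃ σ : ℕ → ℕ, StrictMono σ ∧ ∃ ξ η : M, ConvergesAway (g ∘ σ) ξ η

/-- The limit set of a subgroup `H`: the attracting points of the convergence sequences of pairwise
distinct elements of `H`. It is empty for finite `H`. -/
def limitSet {Γ : Type*} (M : Type*) [Group Γ] [TopologicalSpace M] [MulAction Γ M]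
    (H : Subgroup Γ) : Set M :=
  {ξ | ∃ g : ℕ → Γ, Function.Injective g ∧ (∀ n, g n ∈ H) ∧ ∃ η : M, ConvergesAway g ξ η}

/-- A convergence action is non-elementary if its limit set has more than two points. -/
def IsNonelementaryAction (Γ M : Type*) [Group Γ] [TopologicalSpace M] [MulAction Γ M] : Prop :=
  IsConvergenceAction Γ M ∧ 2 < (limitSet M (⊤ : Subgroup Γ)).encard

/-- `Γ` has a convergence action on a compact metrizable space. -/
def IsConvergenceGroup (Γ : Type u) [Group Γ] : Prop :=
  ∃ (M : Type u) (_ : TopologicalSpace M) (_ : MulAction Γ M),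
    CompactSpace M ∧ TopologicalSpace.MetrizableSpace M ∧ IsConvergenceAction Γ M

/-- `Γ` has a non-elementary convergence action on a compact metrizable space. -/
def IsNonelementaryConvergenceGroup (Γ : Type u) [Group Γ] : Prop :=
  ∃ (M : Type u) (_ : TopologicalSpace M) (_ : MulAction Γ M),
    CompactSpace M ∧ TopologicalSpace.MetrizableSpace M ∧ IsNonelementaryAction Γ M

/-- `H` is dynamically quasi-convex: for disjoint closed `K`, `L`, only finitely many cosets `gH`
have a translate `gΛ(H)` that meets both `K` and `L`. -/
def IsDynamicallyQuasiconvex {Γ : Type*} (M : Type*) [Group Γ] [TopologicalSpace M]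
    [MulAction Γ M] (H : Subgroup Γ) : Prop :=
  ∀ K L : Set M, IsClosed K → IsClosed L → Disjoint K L →
    {c : Γ ⧸ H | ∃ g : Γ, (g : Γ ⧸ H) = c ∧
      ((g • limitSet M H) ∩ K).Nonempty ∧ ((g • limitSet M H) ∩ L).Nonempty}.Finite

/-- `H` is dynamically malnormal: `gΛ(H)` is disjoint from `Λ(H)` for all `g ∉ H`. -/
def IsDynamicallyMalnormal {Γ : Type*} (M : Type*) [Group Γ] [TopologicalSpace M]
    [MulAction Γ M] (H : Subgroup Γ) : Prop :=
  ∀ g : Γ, g ∉ H → Disjoint (g • limitSet M H) (limitSet M H)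

/-- An indexed family of subgroups is dynamically malnormal: each member is, and `gΛ(H i)` is
disjoint from `Λ(H j)` unless `i = j` and `g ∈ H i`. -/
def IsDynamicallyMalnormalFamily {Γ ι : Type*} (M : Type*) [Group Γ] [TopologicalSpace M]
    [MulAction Γ M] (H : ι → Subgroup Γ) : Prop :=
  (∀ i, IsDynamicallyMalnormal M (H i)) ∧
    ∀ (g : Γ) (i j : ι), ¬ (i = j ∧ g ∈ H i) →
      Disjoint (g • limitSet M (H i)) (limitSet M (H j))

end Convergence

/-! ## Graphs of groups -/

/-- A graph of groups with vertex set `V` and edge set `E`. Each edge is listed once, with an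
arbitrary orientation from `src e` to `tgt e`; loops and multiple edges are allowed. -/
structure GraphOfGroups (V E : Type u) where
  src : E → V
  tgt : E → V
  vertexGroup : V → Type u
  edgeGroup : E → Type u
  [vertexGroupInst : ∀ v, Group (vertexGroup v)]
  [edgeGroupInst : ∀ e, Group (edgeGroup e)]
  srcMap : ∀ e, edgeGroup e →* vertexGroup (src e)
  tgtMap : ∀ e, edgeGroup e →* vertexGroup (tgt e)
  srcMap_injective : ∀ e, Function.Injective (srcMap e)
  tgtMap_injective : ∀ e, Function.Injective (tgtMap e)

namespace GraphOfGroups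

attribute [instance] GraphOfGroups.vertexGroupInst GraphOfGroups.edgeGroupInst

variable {V E : Type u} (𝒢 : GraphOfGroups V E)

/-- The underlying graph is connected (and non-empty). -/
def Connected : Prop :=
  Nonempty V ∧ ∀ v w : V, Relation.ReflTransGen
    (fun a b => ∃ e, (𝒢.src e = a ∧ 𝒢.tgt e = b) ∨ (𝒢.src e = b ∧ 𝒢.tgt e = a)) v w

/-- The ends of edges at a vertex; a loop has two different ends at its vertex. -/
inductive EdgeEnd : V → Type u
  | atSrc (e : E) : EdgeEnd (𝒢.src e)
  | atTgt (e : E) : EdgeEnd (𝒢.tgt e)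

/-- The image of the edge group in the vertex group at an end of the edge. -/
def edgeSubgroup : ∀ {v : V}, 𝒢.EdgeEnd v → Subgroup (𝒢.vertexGroup v)
  | _, .atSrc e => (𝒢.srcMap e).range
  | _, .atTgt e => (𝒢.tgtMap e).range

/-- The stabilizer in the vertex group of the limit set of an incident edge group. -/
def limitSetStabilizer (X : V → Type u) [∀ v, TopologicalSpace (X v)]
    [∀ v, MulAction (𝒢.vertexGroup v) (X v)] {v : V} (i : 𝒢.EdgeEnd v) :
    Subgroup (𝒢.vertexGroup v) :=
  MulAction.stabilizer (𝒢.vertexGroup v) (limitSet (X v) (𝒢.edgeSubgroup i))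

/-- The free product of all vertex groups and of the free group on the edges. -/
abbrev PreWordGroup : Type u :=
  Monoid.Coprod (Monoid.CoprodI 𝒢.vertexGroup) (FreeGroup E)

/-- An element of a vertex group, in the free product. -/
def preVertex {v : V} (g : 𝒢.vertexGroup v) : 𝒢.PreWordGroup :=
  Monoid.Coprod.inl (Monoid.CoprodI.of g)

/-- The letter of an edge, in the free product. -/
def preEdge (e : E) : 𝒢.PreWordGroup :=
  Monoid.Coprod.inr (FreeGroup.of e)

/-- The relators `t_e · tgtMap e a · t_e⁻¹ · (srcMap e a)⁻¹`. -/
def relators : Set 𝒢.PreWordGroup :=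
  {x | ∃ (e : E) (a : 𝒢.edgeGroup e),
    x = 𝒢.preEdge e * 𝒢.preVertex (𝒢.tgtMap e a) * (𝒢.preEdge e)⁻¹ *
      (𝒢.preVertex (𝒢.srcMap e a))⁻¹}

/-- Serre's group `F(𝒢)`: generated by the vertex groups and one letter `t_e` for each edge, with
the relations `t_e · tgtMap e a · t_e⁻¹ = srcMap e a`. -/
abbrev WordGroup : Type u :=
  𝒢.PreWordGroup ⧸ Subgroup.normalClosure 𝒢.relators

/-- `𝒢.IsPathElement v w x`: the element `x` of `F(𝒢)` is the product `g₀ t₁ g₁ ⋯ tₙ gₙ` along some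
path of the graph from `v` to `w`, each `gᵢ` in the group of the vertex reached. -/
inductive IsPathElement : V → V → 𝒢.WordGroup → Prop
  | vertex (v : V) (g : 𝒢.vertexGroup v) :
      IsPathElement v v (QuotientGroup.mk (𝒢.preVertex g))
  | edge (e : E) : IsPathElement (𝒢.src e) (𝒢.tgt e) (QuotientGroup.mk (𝒢.preEdge e))
  | edgeInv (e : E) : IsPathElement (𝒢.tgt e) (𝒢.src e) (QuotientGroup.mk (𝒢.preEdge e))⁻¹
  | mul {a b c : V} {x y : 𝒢.WordGroup} :
      IsPathElement a b x → IsPathElement b c y → IsPathElement a c (x * y)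

theorem IsPathElement.one (v : V) : 𝒢.IsPathElement v v 1 := by
  have h := IsPathElement.vertex (𝒢 := 𝒢) v 1
  simpa [preVertex] using h

theorem IsPathElement.inv {a b : V} {x : 𝒢.WordGroup} (h : 𝒢.IsPathElement a b x) :
    𝒢.IsPathElement b a x⁻¹ := by
  induction h with
  | vertex v g =>
    have h := IsPathElement.vertex (𝒢 := 𝒢) v g⁻¹
    simpa [preVertex] using h
  | edge e => exact .edgeInv e
  | edgeInv e => rw [inv_inv]; exact .edge e
  | mul _ _ h₁ h₂ => rw [mul_inv_rev]; exact .mul h₂ h₁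

/-- The fundamental group of the graph of groups at `v₀`: the elements of `F(𝒢)` that come from
closed paths at `v₀`. -/
def fundamentalGroup (v₀ : V) : Subgroup 𝒢.WordGroup where
  carrier := {x | 𝒢.IsPathElement v₀ v₀ x}
  mul_mem' := IsPathElement.mul
  one_mem' := IsPathElement.one 𝒢 v₀
  inv_mem' := IsPathElement.inv 𝒢

end GraphOfGroups

/-! ## Convergence sequences -/

section ConvergenceBasics

variable {A X : Type*} [Group A] [TopologicalSpace X] [MulAction A X]

/-! Fix a vertex `v` with group `A`, and let `G` be the fundamental group at `v`. If `A = G`, the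
given action on `X v` will do. Otherwise collapse every translate of a limit set `Λ(H_i)` in `X v`
to a point. Malnormality makes the translates equal or disjoint and quasi-convexity makes the
relation closed, so the quotient `Y` is compact metrizable with a convergence action of `A`, and
each `H_i` now fixes a parabolic point `q i` (`exists_parabolic_collapse`).

Thus each edge `g • i` of the Bass–Serre tree at the base vertex has a point `g • q i` of `Y`. For
`g ∉ A`, let `P g` be the point of the first edge on the path from the base vertex to its translate
by `g`. A point of the new space records its projection to every translate of `Y`: it is an
equivariant `f : G → Y` such that, of any two different translates, at least one carries as its
value the direction of the other. These families form a closed subset of `G → Y`, metrizable since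
`G` is countable. Translates of a single vertex space suffice.

For convergence, extract a subsequence for which every `x⁻¹ * g n * w` either has limiting
directions or stays in `A` and converges there. The limit seen from `x` does not depend on `w`
(`attracting_eq`): two translates lie in different directions only from the finitely many vertices
between them, and inside `A` a parabolic point is not conical
(`IsParabolicPoint.tendsto_of_convergesAway`). The limits form the attracting and the repelling
family, and any family that differs from the repelling one at some `w` is drawn to the attracting
one.

The combinatorics of the tree is read off from a ping-pong action of Serre's group
(`exists_pingPong`), which also shows that vertex groups embed. For non-elementarity, the collapse
keeps more than two limit points, and evaluation at `1` sends the limit set of `G` onto a set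
containing that of `A` in `Y`. -/

theorem IsConvergenceAction.continuousConstSMul (h : IsConvergenceAction A X) :
    ContinuousConstSMul A X :=
  ⟨h.continuous_smul⟩

theorem ConvergesAway.comp_tendsto {g : ℕ → A} {ξ η : X} (h : ConvergesAway g ξ η) {τ : ℕ → ℕ}
    (hτ : Tendsto τ atTop atTop) : ConvergesAway (g ∘ τ) ξ η :=
  fun K hK hη U hU => hτ.eventually (h K hK hη U hU)

theorem ConvergesAway.congr {g g' : ℕ → A} {ξ η : X} (h : ConvergesAway g ξ η)
    (hg : g =ᶠ[atTop] g') : ConvergesAway g' ξ η := by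
  intro K hK hη U hU
  filter_upwards [h K hK hη U hU, hg] with n hn hgn
  rwa [← hgn]

theorem ConvergesAway.tendsto {g : ℕ → A} {ξ η : X} (h : ConvergesAway g ξ η) {x : X}
    (hx : x ≠ η) : Tendsto (fun n => g n • x) atTop (𝓝 ξ) := by
  refine fun U hU => mem_map.2 ?_
  filter_upwards [h {x} isCompact_singleton (by simpa using hx.symm) U hU] with n hn
  exact hn x rfl

theorem ConvergesAway.tendsto_seq [T2Space X] [CompactSpace X] {g : ℕ → A} {ξ η y : X}
    (h : ConvergesAway g ξ η) {x : ℕ → X} (hx : Tendsto x atTop (𝓝 y)) (hy : y ≠ η) :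
    Tendsto (fun n => g n • x n) atTop (𝓝 ξ) := by
  refine fun U hU => mem_map.2 ?_
  obtain ⟨V, W, hV, hW, hyV, hηW, hVW⟩ := t2_separation hy
  filter_upwards [h Wᶜ hW.isClosed_compl.isCompact (by simpa using hηW) U hU,
    hx.eventually (hV.mem_nhds hyV)] with n hn hxn
  exact hn _ fun hxW => hVW.ne_of_mem hxn hxW rfl

/-- Contraposition: once `g n` sends the complement of an open `O ∋ η` off `K`, its inverse must
send `K` into `O`. -/
theorem ConvergesAway.inv [T2Space X] [CompactSpace X] {g : ℕ → A} {ξ η : X}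
    (h : ConvergesAway g ξ η) : ConvergesAway (fun n => (g n)⁻¹) η ξ := by
  intro K hK hξ U hU
  obtain ⟨O, hOU, hO, hηO⟩ := mem_nhds_iff.1 hU
  filter_upwards [h Oᶜ hO.isClosed_compl.isCompact (by simpa using hηO) Kᶜ
    (hK.isClosed.isOpen_compl.mem_nhds hξ)] with n hn x hx
  by_contra hxU
  have := hn ((g n)⁻¹ • x) fun hxO => hxU (hOU hxO)
  rw [smul_inv_smul] at this
  exact this hx

theorem ConvergesAway.mul_left [ContinuousConstSMul A X] {g : ℕ → A} {ξ η : X}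
    (h : ConvergesAway g ξ η) (a : A) : ConvergesAway (fun n => a * g n) (a • ξ) η := by
  intro K hK hη U hU
  filter_upwards [h K hK hη _ ((continuous_const_smul a).continuousAt hU)] with n hn x hx
  rw [mul_smul]
  exact hn x hx

theorem ConvergesAway.mul_right [ContinuousConstSMul A X] {g : ℕ → A} {ξ η : X}
    (h : ConvergesAway g ξ η) (a : A) : ConvergesAway (fun n => g n * a) ξ (a⁻¹ • η) := by
  intro K hK hη U hU
  have hK' : IsCompact (a • K) := hK.image (continuous_const_smul a)
  filter_upwards [h (a • K) hK' (by rwa [Set.mem_smul_set_iff_inv_smul_mem]) U hU] with n hn x hx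
  rw [mul_smul]
  exact hn _ (Set.smul_mem_smul_set hx)

theorem ConvergesAway.conj [ContinuousConstSMul A X] {g : ℕ → A} {ξ η : X}
    (h : ConvergesAway g ξ η) (a : A) :
    ConvergesAway (fun n => a * g n * a⁻¹) (a • ξ) (a • η) := by
  simpa using (h.mul_left a).mul_right a⁻¹

/-- A sequence that escapes every finite set has an injective subsequence. -/
theorem exists_strictMono_injective_comp {α : Type*} {a : ℕ → α}
    (ha : Tendsto a atTop cofinite) :
    ∃ φ : ℕ → ℕ, StrictMono φ ∧ Function.Injective (a ∘ φ) := by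
  classical
  obtain ⟨φ, -, hφ⟩ := exists_seq_of_forall_finset_exists (fun _ : ℕ => True)
    (fun m n => m < n ∧ a m ≠ a n) fun s _ => by
      have h1 : ∀ᶠ n in atTop, ∀ m ∈ s, m < n ∧ a m ≠ a n := by
        rw [eventually_all_finset]
        intro m _
        have := ha.eventually (eventually_cofinite_ne (a m))
        filter_upwards [this, eventually_gt_atTop m] with n hn hmn
        exact ⟨hmn, hn.symm⟩
      obtain ⟨n, hn⟩ := h1.exists
      exact ⟨n, trivial, hn⟩
  refine ⟨φ, fun m n h => (hφ m n h).1, fun m n h => ?_⟩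
  by_contra hne
  rcases lt_or_gt_of_ne hne with h' | h'
  · exact (hφ m n h').2 h
  · exact (hφ n m h').2 h.symm

theorem IsConvergenceAction.exists_subseq_of_tendsto_cofinite (hA : IsConvergenceAction A X)
    {a : ℕ → A} (ha : Tendsto a atTop cofinite) :
    ∃ σ : ℕ → ℕ, StrictMono σ ∧ ∃ ξ η : X, ConvergesAway (a ∘ σ) ξ η := by
  obtain ⟨φ, hφ, hinj⟩ := exists_strictMono_injective_comp ha
  obtain ⟨σ, hσ, ξ, η, h⟩ := hA.exists_subseq _ hinj
  exact ⟨φ ∘ σ, hφ.comp hσ, ξ, η, h⟩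

end ConvergenceBasics

/-! ## Limit sets -/

section LimitSet

variable {A X : Type*} [Group A] [TopologicalSpace X] [MulAction A X]

theorem limitSet_mono {H K : Subgroup A} (h : H ≤ K) : limitSet X H ⊆ limitSet X K := by
  rintro ξ ⟨g, hg, hgH, η, hη⟩
  exact ⟨g, hg, fun n => h (hgH n), η, hη⟩

theorem limitSet_nonempty (hA : IsConvergenceAction A X) (H : Subgroup A) [Infinite H] :
    (limitSet X H).Nonempty := by
  obtain ⟨σ, hσ, ξ, η, h⟩ := hA.exists_subseq (fun n => (Infinite.natEmbedding H n : A))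
    (Subtype.val_injective.comp (Infinite.natEmbedding H).injective)
  exact ⟨ξ, _, (Subtype.val_injective.comp (Infinite.natEmbedding H).injective).comp hσ.injective,
    fun n => Subtype.property _, η, h⟩

theorem smul_mem_limitSet [ContinuousConstSMul A X] {H : Subgroup A} {g : A} (hg : g ∈ H) {x : X}
    (hx : x ∈ limitSet X H) : g • x ∈ limitSet X H := by
  obtain ⟨h, hinj, hH, η, hη⟩ := hx
  exact ⟨fun n => g * h n, (mul_right_injective g).comp hinj, fun n => H.mul_mem hg (hH n), η,
    hη.mul_left g⟩

theorem smul_limitSet_eq [ContinuousConstSMul A X] {H : Subgroup A} {g : A} (hg : g ∈ H) :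
    g • limitSet X H = limitSet X H := by
  apply Set.Subset.antisymm
  · rintro _ ⟨x, hx, rfl⟩
    exact smul_mem_limitSet hg hx
  · intro x hx
    rw [Set.mem_smul_set_iff_inv_smul_mem]
    exact smul_mem_limitSet (H.inv_mem hg) hx

theorem repelling_mem_limitSet [T2Space X] [CompactSpace X] {H : Subgroup A} {g : ℕ → A}
    (hg : Function.Injective g) (hgH : ∀ n, g n ∈ H) {ξ η : X} (h : ConvergesAway g ξ η) :
    η ∈ limitSet X H :=
  ⟨fun n => (g n)⁻¹, inv_injective.comp hg, fun n => H.inv_mem (hgH n), ξ, h.inv⟩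

/-- Diagonal choice: from a sequence attracted to `z (φ k)`, pick an element different from all
earlier ones that sends the complement of the `1/(k+1)`-ball about the repelling point into the
`1/(k+1)`-ball about `z (φ k)`. The repelling points converge after extraction. -/
theorem isClosed_limitSet [CompactSpace X] [TopologicalSpace.MetrizableSpace X]
    (H : Subgroup A) : IsClosed (limitSet X H) := by
  classical
  let _ := TopologicalSpace.metrizableSpaceMetric X
  refine isClosed_of_closure_subset fun ξ hξ => ?_
  rw [mem_closure_iff_seq_limit] at hξ
  obtain ⟨z, hz, hzξ⟩ := hξ
  choose g hinj hH η hη using hz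
  obtain ⟨η', -, φ, hφ, hη'⟩ := isCompact_univ.tendsto_subseq (x := η) fun n => Set.mem_univ _
  have key : ∀ s : Finset (ℕ × A), (∀ x ∈ s, x.2 ∈ H ∧
      ∀ x' : X, 1 / (x.1 + 1 : ℝ) ≤ dist x' (η (φ x.1)) →
        dist (x.2 • x') (z (φ x.1)) < 1 / (x.1 + 1 : ℝ)) → ∃ y : ℕ × A, (y.2 ∈ H ∧
      ∀ x' : X, 1 / (y.1 + 1 : ℝ) ≤ dist x' (η (φ y.1)) →
        dist (y.2 • x') (z (φ y.1)) < 1 / (y.1 + 1 : ℝ)) ∧ ∀ x ∈ s, x.1 < y.1 ∧ x.2 ≠ y.2 := by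
    intro s _
    set k := s.sup Prod.fst + 1 with hk
    have hpos : (0 : ℝ) < 1 / (k + 1 : ℝ) := by positivity
    have h1 := hη (φ k) {x' | 1 / (k + 1 : ℝ) ≤ dist x' (η (φ k))}
      (isClosed_le continuous_const (continuous_id.dist continuous_const)).isCompact
      (by simpa using hpos) _ (Metric.ball_mem_nhds (z (φ k)) hpos)
    have h2 : ∀ᶠ n in atTop, ∀ x ∈ s, x.2 ≠ g (φ k) n := by
      rw [eventually_all_finset]
      intro x _
      have h3 := (hinj (φ k)).tendsto_cofinite.eventually (eventually_cofinite_ne x.2)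
      rw [Nat.cofinite_eq_atTop] at h3
      exact h3.mono fun n hn => hn.symm
    obtain ⟨n, hn1, hn2⟩ := (h1.and h2).exists
    exact ⟨(k, g (φ k) n), ⟨hH _ _, hn1⟩,
      fun x hx => ⟨Nat.lt_succ_of_le (Finset.le_sup (f := Prod.fst) hx), hn2 x hx⟩⟩
  obtain ⟨f, hf, hf'⟩ := exists_seq_of_forall_finset_exists _ _ key
  have hmono : StrictMono fun n => (f n).1 := fun m n h => (hf' m n h).1
  have hsmall : Tendsto (fun n => 1 / ((f n).1 + 1 : ℝ)) atTop (𝓝 0) :=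
    tendsto_one_div_add_atTop_nhds_zero_nat.comp hmono.tendsto_atTop
  refine ⟨fun n => (f n).2, fun m n h => ?_, fun n => (hf n).1, η', fun K hK hηK U hU => ?_⟩
  · by_contra hne
    rcases lt_or_gt_of_ne hne with h' | h'
    · exact (hf' m n h').2 h
    · exact (hf' n m h').2 h.symm
  · obtain ⟨ε, hε, hεK⟩ := Metric.isOpen_iff.1 hK.isClosed.isOpen_compl η' hηK
    obtain ⟨δ, hδ, hδU⟩ := Metric.mem_nhds_iff.1 hU
    have h1 := (hη'.comp hmono.tendsto_atTop).eventually (Metric.ball_mem_nhds η' (half_pos hε))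
    have h2 := (hzξ.comp (hφ.comp hmono).tendsto_atTop).eventually
      (Metric.ball_mem_nhds ξ (half_pos hδ))
    filter_upwards [h1, h2, hsmall.eventually (gt_mem_nhds (half_pos hε)),
      hsmall.eventually (gt_mem_nhds (half_pos hδ))] with n hn1 hn2 hn3 hn4 x hx
    simp only [Function.comp_apply] at hn1 hn2
    have h3 : ε ≤ dist x η' := by
      by_contra hlt
      exact hεK (Metric.mem_ball.2 (not_le.1 hlt)) hx
    have h4 := (hf n).2 x (by
      have := dist_triangle x (η (φ (f n).1)) η'
      linarith)
    refine hδU (Metric.mem_ball.2 ?_)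
    have := dist_triangle ((f n).2 • x) (z (φ (f n).1)) ξ
    linarith

end LimitSet

/-! ## Parabolic points are not conical -/

section Parabolic

variable {A X : Type*} [Group A] [TopologicalSpace X] [MulAction A X]

/-- A point with infinite stabilizer, all of whose sequences of distinct elements converge to the
point locally uniformly away from it. -/
def IsParabolicPoint (A : Type*) {X : Type*} [Group A] [TopologicalSpace X] [MulAction A X]
    (p : X) : Prop :=
  Infinite (MulAction.stabilizer A p) ∧
    ∀ h : ℕ → A, Function.Injective h → (∀ n, h n • p = p) → ConvergesAway h p p

theorem IsParabolicPoint.exists_seq {p : X} (hp : IsParabolicPoint A p) :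
    ∃ h : ℕ → A, Function.Injective h ∧ ∀ n, h n • p = p := by
  have := hp.1
  exact ⟨fun n => (Infinite.natEmbedding (MulAction.stabilizer A p) n : A),
    Subtype.val_injective.comp (Infinite.natEmbedding _).injective,
    fun n => (Infinite.natEmbedding (MulAction.stabilizer A p) n).2⟩

theorem IsParabolicPoint.smul [ContinuousConstSMul A X] {p : X} (hp : IsParabolicPoint A p)
    (a : A) : IsParabolicPoint A (a • p) := by
  obtain ⟨h, hinj, hfix⟩ := hp.exists_seq
  refine ⟨?_, fun k hk hkp => ?_⟩
  · refine Infinite.of_injective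
      (fun n => (⟨a * h n * a⁻¹, by simp [mul_smul, hfix]⟩ : MulAction.stabilizer A (a • p))) ?_
    intro m n hmn
    exact hinj (mul_left_cancel (mul_right_cancel (congrArg Subtype.val hmn)))
  · have h1 := hp.2 (fun n => a⁻¹ * k n * a)
      (fun m n hmn => hk (mul_left_cancel (mul_right_cancel hmn)))
      (fun n => by rw [mul_smul, mul_smul, hkp, inv_smul_smul])
    simpa [mul_assoc] using h1.conj a

/-- In a two-point space the stabilizer of `p` would also fix `x`, yet its sequences of distinct
elements must draw `x` to `p`. -/
theorem IsParabolicPoint.exists_ne_ne [T2Space X] {p x : X} (hp : IsParabolicPoint A p)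
    (hx : x ≠ p) (ζ ξ : X) : ∃ z : X, z ≠ ζ ∧ z ≠ ξ := by
  by_contra! hcon
  obtain ⟨h, hinj, hfix⟩ := hp.exists_seq
  have hlim := (hp.2 h hinj hfix).tendsto hx
  have hall : ∀ n, h n • x = x := by
    intro n
    have hne : h n • x ≠ p := by
      intro heq
      rw [← hfix n] at heq
      exact hx (MulAction.injective _ heq)
    by_cases h1 : p = ζ
    · exact (hcon _ (h1 ▸ hne)).trans (hcon x (h1 ▸ hx)).symm
    · have hζ : ∀ y, y ≠ p → y = ζ := fun y hy => by
        by_contra hyζ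
        exact hy ((hcon y hyζ).trans (hcon p h1).symm)
      exact (hζ _ hne).trans (hζ x hx).symm
  simp only [hall] at hlim
  exact hx (tendsto_nhds_unique tendsto_const_nhds hlim)

/-- The conjugate `s * h * s⁻¹` fixes `s • p ∈ W₁`, but its positive powers trap `z` in `W₂`. As `z
∉ W₂`, the powers are distinct, so parabolicity would draw `z` into `W₁`. -/
theorem false_of_parabolic_of_smul_compl_subset [ContinuousConstSMul A X] {p z : X}
    (hp : IsParabolicPoint A p) {s h : A} (hh : h • p = p) {W₁ W₂ : Set X} (hW₁ : IsOpen W₁)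
    (hW : Disjoint W₁ W₂) (hsp : s • p ∈ W₁) (hz₁ : z ∉ W₁) (hz₂ : z ∉ W₂)
    (hf : ∀ x, x ∉ W₁ → (s * h * s⁻¹) • x ∈ W₂) : False := by
  have hpow : ∀ k : ℕ, (s * h * s⁻¹) ^ (k + 1) • z ∈ W₂ := by
    intro k
    induction k with
    | zero => simpa using hf z hz₁
    | succ k ih =>
      rw [pow_succ', mul_smul]
      exact hf _ fun hmem => hW.ne_of_mem hmem ih rfl
  have hinj : Function.Injective fun k : ℕ => h ^ k := by
    rw [injective_pow_iff_not_isOfFinOrder, isOfFinOrder_iff_pow_eq_one]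
    rintro ⟨k, hk, hk1⟩
    have := hpow (k - 1)
    rw [Nat.sub_add_cancel hk, conj_pow, hk1] at this
    simp only [mul_one, mul_inv_cancel, one_smul] at this
    exact hz₂ this
  have hconv := ((hp.2 _ hinj fun n => by
    have : h ^ n ∈ MulAction.stabilizer A p := Subgroup.pow_mem _ hh n
    exact this).conj s).tendsto (x := z) (by rintro rfl; exact hz₁ hsp)
  obtain ⟨n, hn, hn1⟩ := ((hconv.eventually (hW₁.mem_nhds hsp)).and (eventually_ge_atTop 1)).exists
  obtain ⟨k, rfl⟩ := Nat.exists_eq_add_of_le' hn1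
  rw [← conj_pow] at hn
  exact hW.ne_of_mem hn (hpow k) rfl

/-- Along a convergent subsequence, points that stay away from the repelling point go to the
attracting point. So each of the nearly fixed points `ζ`, `ξ` is one of these two, and being
distinct they are both. -/
theorem IsConvergenceAction.exists_smul_compl_subset [T2Space X] [CompactSpace X]
    (hA : IsConvergenceAction A X) {g : ℕ → A} (hg : Function.Injective g) {u u' : ℕ → X} {ζ ξ : X}
    (hne : ζ ≠ ξ) (hu : Tendsto u atTop (𝓝 ζ)) (hgu : Tendsto (fun n => g n • u n) atTop (𝓝 ζ))
    (hu' : Tendsto u' atTop (𝓝 ξ)) (hgu' : Tendsto (fun n => g n • u' n) atTop (𝓝 ξ))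
    {W₁ W₂ : Set X} (hW₁ : IsOpen W₁) (hW₂ : IsOpen W₂) (hζ : ζ ∈ W₁) (hξ : ξ ∈ W₂) (N : ℕ) :
    ∃ n ≥ N, (∀ x, x ∉ W₂ → g n • x ∈ W₁) ∨ (∀ x, x ∉ W₁ → g n • x ∈ W₂) := by
  obtain ⟨σ, hσ, a, b, hab⟩ := hA.exists_subseq g hg
  have key : ∀ {v : ℕ → X} {y : X}, Tendsto v atTop (𝓝 y) →
      Tendsto (fun n => g n • v n) atTop (𝓝 y) → y = a ∨ y = b := by
    intro v y hv hgv
    by_cases hyb : y = b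
    · exact .inr hyb
    · exact .inl (tendsto_nhds_unique (hgv.comp hσ.tendsto_atTop)
        (hab.tendsto_seq (hv.comp hσ.tendsto_atTop) hyb))
  have main : ∀ {ζ ξ : X} {W₁ W₂ : Set X}, IsOpen W₁ → IsOpen W₂ → ζ ∈ W₁ → ξ ∈ W₂ → ζ = a →
      ξ = b → ∃ n ≥ N, ∀ x, x ∉ W₂ → g n • x ∈ W₁ := by
    rintro ζ ξ W₁ W₂ hW₁ hW₂ hζ hξ rfl rfl
    obtain ⟨n, hn, hnN⟩ := ((hab W₂ᶜ hW₂.isClosed_compl.isCompact (by simpa using hξ) W₁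
      (hW₁.mem_nhds hζ)).and (eventually_ge_atTop N)).exists
    exact ⟨σ n, hnN.trans (hσ.id_le n), hn⟩
  rcases key hu hgu with h1 | h1 <;> rcases key hu' hgu' with h2 | h2
  · exact absurd (h1.trans h2.symm) hne
  · obtain ⟨n, hn, h⟩ := main hW₁ hW₂ hζ hξ h1 h2
    exact ⟨n, hn, .inl h⟩
  · obtain ⟨n, hn, h⟩ := main hW₂ hW₁ hξ hζ h2 h1
    exact ⟨n, hn, .inr h⟩
  · exact absurd (h1.trans h2.symm) hne

/-- A parabolic point is not conical: a sequence that repels from `p` to `ξ` moves `p` to `ξ`. -/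
theorem IsParabolicPoint.tendsto_of_convergesAway [CompactSpace X]
    [TopologicalSpace.MetrizableSpace X] (hA : IsConvergenceAction A X) {p ξ : X}
    (hp : IsParabolicPoint A p) {s : ℕ → A} (hs : ConvergesAway s ξ p) :
    Tendsto (fun n => s n • p) atTop (𝓝 ξ) := by
  classical
  have := hA.continuousConstSMul
  let _ := TopologicalSpace.metrizableSpaceMetric X
  refine tendsto_of_subseq_tendsto fun ns hns => ?_
  obtain ⟨ζ, -, φ, hφ, hζ⟩ := isCompact_univ.tendsto_subseq (x := fun n => s (ns n) • p)
    fun n => Set.mem_univ _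
  refine ⟨φ, ?_⟩
  suffices ζ = ξ by rw [← this]; exact hζ
  by_contra hne
  have hs' := hs.comp_tendsto (hns.comp hφ.tendsto_atTop)
  set t : ℕ → A := s ∘ (ns ∘ φ) with ht
  replace hζ : Tendsto (fun n => t n • p) atTop (𝓝 ζ) := hζ
  clear_value t
  obtain ⟨x, hx⟩ : ∃ x, x ≠ p := by
    by_contra! hcon
    exact hne ((hcon ζ).trans (hcon ξ).symm)
  obtain ⟨z, hzζ, hzξ⟩ := hp.exists_ne_ne hx ζ ξ
  obtain ⟨V₁, V₂, hV₁, hV₂, hζV, hξV, hV⟩ := t2_separation hne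
  obtain ⟨h, hinj, hfix⟩ := hp.exists_seq
  have hhx : ∀ n, h n • x ≠ p := fun n heq => hx (MulAction.injective (h n) (heq.trans (hfix n).symm))
  -- An entry is an accuracy, an index `n` and an element `h` fixing `p`. The conjugate of `h` by `t
  -- n` fixes `t n • p`, close to `ζ`, and moves `t n • x` to `t n • h • x`, close to `ξ`; these
  -- conjugates are to be made pairwise distinct.
  have key : ∀ S : Finset (ℕ × ℕ × A), (∀ y ∈ S, y.2.2 • p = p ∧
      dist (t y.2.1 • y.2.2 • x) ξ < 1 / (y.1 + 1 : ℝ) ∧ y.1 ≤ y.2.1) →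
      ∃ y : ℕ × ℕ × A, (y.2.2 • p = p ∧
      dist (t y.2.1 • y.2.2 • x) ξ < 1 / (y.1 + 1 : ℝ) ∧ y.1 ≤ y.2.1) ∧
      ∀ w ∈ S, w.1 < y.1 ∧ t w.2.1 * w.2.2 * (t w.2.1)⁻¹ ≠ t y.2.1 * y.2.2 * (t y.2.1)⁻¹ := by
    intro S _
    set k := S.sup Prod.fst + 1 with hk
    have hpos : (0 : ℝ) < 1 / (k + 1 : ℝ) := by positivity
    have h1 : ∀ᶠ n in atTop, ∀ j ∈ Finset.range (S.card + 1),
        dist (t n • h j • x) ξ < 1 / (k + 1 : ℝ) := by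
      rw [eventually_all_finset]
      intro j _
      exact (hs'.tendsto (hhx j)).eventually (Metric.ball_mem_nhds ξ hpos)
    obtain ⟨n, hn, hnk⟩ := (h1.and (eventually_ge_atTop k)).exists
    -- Pigeonhole: `S.card + 1` distinct conjugates cannot all be among the at most `S.card` used
    -- before.
    obtain ⟨j, hj, hjS⟩ : ∃ j ∈ Finset.range (S.card + 1),
        t n * h j * (t n)⁻¹ ∉ S.image fun w => t w.2.1 * w.2.2 * (t w.2.1)⁻¹ := by
      by_contra! hcon
      have h2 := Finset.card_le_card_of_injOn (s := Finset.range (S.card + 1)) _ hcon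
        fun a _ b _ hab => hinj (mul_left_cancel (mul_right_cancel hab))
      have h3 := Finset.card_image_le (s := S) (f := fun w => t w.2.1 * w.2.2 * (t w.2.1)⁻¹)
      rw [Finset.card_range] at h2
      lia
    refine ⟨(k, n, h j), ⟨hfix j, hn j hj, hnk⟩, fun w hw =>
      ⟨Nat.lt_succ_of_le (Finset.le_sup (f := Prod.fst) hw), fun heq => hjS ?_⟩⟩
    exact Finset.mem_image.2 ⟨w, hw, heq⟩
  obtain ⟨f, hf, hf'⟩ := exists_seq_of_forall_finset_exists _ _ key
  have hmono : StrictMono fun n => (f n).1 := fun m n h => (hf' m n h).1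
  have htop : Tendsto (fun n => (f n).2.1) atTop atTop :=
    tendsto_atTop_mono (fun n => (hf n).2.2) hmono.tendsto_atTop
  set g : ℕ → A := fun n => t (f n).2.1 * (f n).2.2 * (t (f n).2.1)⁻¹ with hg
  have hginj : Function.Injective g := by
    intro m n hmn
    by_contra hne
    rcases lt_or_gt_of_ne hne with h' | h'
    · exact (hf' m n h').2 hmn
    · exact (hf' n m h').2 hmn.symm
  have hu : Tendsto (fun n => t (f n).2.1 • p) atTop (𝓝 ζ) := hζ.comp htop
  have hgu : Tendsto (fun n => g n • t (f n).2.1 • p) atTop (𝓝 ζ) := by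
    refine hu.congr fun n => ?_
    rw [hg]
    simp only [mul_smul, inv_smul_smul, (hf n).1]
  have hu' : Tendsto (fun n => t (f n).2.1 • x) atTop (𝓝 ξ) := (hs'.tendsto hx).comp htop
  have hgu' : Tendsto (fun n => g n • t (f n).2.1 • x) atTop (𝓝 ξ) := by
    rw [tendsto_iff_dist_tendsto_zero]
    refine squeeze_zero (fun _ => dist_nonneg) (fun n => ?_)
      (tendsto_one_div_add_atTop_nhds_zero_nat.comp hmono.tendsto_atTop)
    simp only [hg, mul_smul, inv_smul_smul]
    exact (hf n).2.1.le
  obtain ⟨N, hN⟩ := eventually_atTop.1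
    (hu.eventually ((hV₁.inter isOpen_compl_singleton).mem_nhds
      (show ζ ∈ V₁ ∩ {z}ᶜ from ⟨hζV, hzζ.symm⟩)))
  obtain ⟨n, hn, hcase⟩ := hA.exists_smul_compl_subset hginj hne hu hgu hu' hgu'
    (hV₁.inter isOpen_compl_singleton) (hV₂.inter isOpen_compl_singleton)
    (show ζ ∈ V₁ ∩ {z}ᶜ from ⟨hζV, hzζ.symm⟩) (show ξ ∈ V₂ ∩ {z}ᶜ from ⟨hξV, hzξ.symm⟩) N
  have hdisj : Disjoint (V₁ ∩ {z}ᶜ) (V₂ ∩ {z}ᶜ) :=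
    hV.mono Set.inter_subset_left Set.inter_subset_left
  rcases hcase with hc | hc
  -- Here `g n` sends the complement of the second set into the first, so the inverse plays the
  -- required role.
  · refine false_of_parabolic_of_smul_compl_subset (z := z) hp (s := t (f n).2.1)
      (h := (f n).2.2⁻¹) (inv_smul_eq_iff.2 (hf n).1.symm) (hV₁.inter isOpen_compl_singleton) hdisj
      (hN n hn) (by simp) (by simp) fun y hy => ?_
    by_contra hy2
    refine hy ?_
    have := hc _ hy2
    simpa [hg, mul_smul] using this
  · exact false_of_parabolic_of_smul_compl_subset (z := z) hp (hf n).1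
      (hV₁.inter isOpen_compl_singleton) hdisj (hN n hn) (by simp) (by simp) hc

end Parabolic

/-! ## Diagonal subsequences -/

/-- Let `S k` be the result of `k` successive extractions. From `k + 1` on, the diagonal `S n n`
factors through `S (k + 1)` by indices tending to infinity, and this is the stability that `hQ'`
asks of the properties. -/
theorem exists_strictMono_forall {Q : ℕ → (ℕ → ℕ) → Prop}
    (hQ : ∀ k σ, StrictMono σ → ∃ τ : ℕ → ℕ, StrictMono τ ∧ Q k (σ ∘ τ))
    (hQ' : ∀ k σ τ ρ, Q k σ → Tendsto τ atTop atTop → ρ =ᶠ[atTop] σ ∘ τ → Q k ρ) :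
    ∃ σ : ℕ → ℕ, StrictMono σ ∧ ∀ k, Q k σ := by
  choose! T hT hTQ using hQ
  let S : ℕ → ℕ → ℕ := fun n => Nat.rec id (fun k σ => σ ∘ T k σ) n
  have hS : ∀ n, StrictMono (S n) := by
    intro n
    induction n with
    | zero => exact strictMono_id
    | succ n ih => exact ih.comp (hT n _ ih)
  have hfac : ∀ k m, ∃ θ : ℕ → ℕ, StrictMono θ ∧ S (k + m) = S k ∘ θ := by
    intro k m
    induction m with
    | zero => exact ⟨id, strictMono_id, rfl⟩
    | succ m ih =>
      obtain ⟨θ, hθ, h⟩ := ih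
      refine ⟨θ ∘ T (k + m) (S (k + m)), hθ.comp (hT _ _ (hS _)), ?_⟩
      rw [← Function.comp_assoc, ← h]
      rfl
  choose θ hθ hSθ using hfac
  refine ⟨fun n => S n n, strictMono_nat_of_lt_succ fun n => ?_, fun k => ?_⟩
  · calc S n n < S n (n + 1) := hS n n.lt_succ_self
      _ ≤ S n (T n (S n) (n + 1)) := (hS n).monotone ((hT n _ (hS n)).id_le _)
  · refine hQ' k (S (k + 1)) (fun n => θ (k + 1) (n - (k + 1)) n) _ (hTQ k _ (hS k)) ?_ ?_
    · exact tendsto_atTop_mono (fun n => (hθ _ _).id_le n) tendsto_id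
    · filter_upwards [eventually_ge_atTop (k + 1)] with n hn
      have := hSθ (k + 1) (n - (k + 1))
      rw [Nat.add_sub_cancel' hn] at this
      rw [this]
      rfl

/-! ## The combination space -/

section Combination

variable {G A Y : Type*} [Group G] [Group A] [MulAction A Y]

/-- A projection of the nontrivial cosets of the image of `A` in `G` to points of `Y`, behaving like
the first edges of the paths from a base vertex to its translates in a tree. -/
structure IsCosetProjection [TopologicalSpace Y] (j : A →* G) (P : G → Y) : Prop where
  map_mul : ∀ a g, g ∉ j.range → P (j a * g) = a • P g
  mul_map : ∀ g a, g ∉ j.range → P (g * j a) = P g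
  eq_or_eq : ∀ x y, x ∉ j.range → y ∉ j.range → x⁻¹ * y ∉ j.range →
    P x = P y ∨ P x⁻¹ = P (x⁻¹ * y)
  finite_ne : ∀ w, ∃ T : Set G, T.Finite ∧ ∀ y, y ∉ j.range → y⁻¹ * w ∉ j.range →
    P y⁻¹ ≠ P (y⁻¹ * w) → ∃ t ∈ T, y⁻¹ * t ∈ j.range
  parabolic : ∀ g, g ∉ j.range → IsParabolicPoint A (P g)

/-- The equivariant families of points, one in each translate of `Y`, that are consistent with the
projections between the translates. -/
def CombinationSpace (j : A →* G) (P : G → Y) : Set (G → Y) :=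
  {f | ∀ x a, f (x * j a) = a⁻¹ • f x} ∩
    {f | ∀ x y, x⁻¹ * y ∉ j.range → f x = P (x⁻¹ * y) ∨ f y = P (y⁻¹ * x)}

namespace CombinationSpace

variable {j : A →* G} {P : G → Y}

instance : MulAction G (CombinationSpace j P) where
  smul γ f := ⟨fun x => f.1 (γ⁻¹ * x), fun x a => by simp only [← mul_assoc, f.2.1 _ _],
    fun x y h => by
      have := f.2.2 (γ⁻¹ * x) (γ⁻¹ * y)
      simp only [mul_inv_rev, inv_inv, mul_assoc, mul_inv_cancel_left] at this
      exact this h⟩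
  one_smul f := Subtype.ext (funext fun x => congrArg f.1 (by simp))
  mul_smul γ δ f := Subtype.ext (funext fun x => congrArg f.1 (by simp [mul_assoc]))

theorem smul_apply (γ : G) (f : CombinationSpace j P) (x : G) : (γ • f).1 x = f.1 (γ⁻¹ * x) := rfl

section Topology

variable [TopologicalSpace Y]

theorem continuous_eval (x : G) : Continuous fun f : CombinationSpace j P => f.1 x :=
  (continuous_apply x).comp continuous_subtype_val

theorem metrizableSpace [Countable G] [CompactSpace Y] [TopologicalSpace.MetrizableSpace Y] :
    TopologicalSpace.MetrizableSpace (CombinationSpace j P) :=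
  inferInstance

theorem compactSpace [CompactSpace Y] [T2Space Y] [ContinuousConstSMul A Y] :
    CompactSpace (CombinationSpace j P) := by
  refine isCompact_iff_compactSpace.1 (IsClosed.isCompact (IsClosed.inter ?_ ?_))
  · simp only [Set.ofPred_forall]
    exact isClosed_iInter fun x => isClosed_iInter fun a => isClosed_eq (continuous_apply _)
      ((continuous_const_smul _).comp (continuous_apply _))
  · simp only [Set.ofPred_forall]
    exact isClosed_iInter fun x => isClosed_iInter fun y => isClosed_iInter fun _ =>
      (isClosed_eq (continuous_apply _) continuous_const).union
        (isClosed_eq (continuous_apply _) continuous_const)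

theorem continuous_smul (γ : G) : Continuous fun f : CombinationSpace j P => γ • f :=
  (continuous_pi fun x => continuous_eval (γ⁻¹ * x)).subtype_mk _

end Topology

end CombinationSpace

/-! ### Limits of sequences of cosets -/

variable [TopologicalSpace Y]

/-- The sequence `s` either leaves the image of `A` and projects to `ξ`, its inverse projecting to
`η`, or it stays in the image of `A` and converges to `ξ` locally uniformly away from `η`. -/
def CosetLimit (j : A →* G) (P : G → Y) (s : ℕ → G) (ξ η : Y) : Prop :=
  ((∀ᶠ n in atTop, s n ∉ j.range) ∧ Tendsto (fun n => P (s n)) atTop (𝓝 ξ) ∧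
    Tendsto (fun n => P (s n)⁻¹) atTop (𝓝 η)) ∨
  ∃ a : ℕ → A, (∀ᶠ n in atTop, s n = j (a n)) ∧ ConvergesAway a ξ η

namespace CosetLimit

variable {j : A →* G} {P : G → Y} {s : ℕ → G} {ξ η : Y}

theorem inv [T2Space Y] [CompactSpace Y] (h : CosetLimit j P s ξ η) :
    CosetLimit j P (fun n => (s n)⁻¹) η ξ := by
  rcases h with ⟨h1, h2, h3⟩ | ⟨a, ha, h⟩
  · exact .inl ⟨by simpa using h1, h3, by simpa using h2⟩
  · exact .inr ⟨fun n => (a n)⁻¹, ha.mono fun n hn => by simp [hn], h.inv⟩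

theorem comp_tendsto {s' : ℕ → G} (h : CosetLimit j P s ξ η) {τ : ℕ → ℕ}
    (hτ : Tendsto τ atTop atTop) (hs : s' =ᶠ[atTop] s ∘ τ) : CosetLimit j P s' ξ η := by
  rcases h with ⟨h1, h2, h3⟩ | ⟨a, ha, h⟩
  · refine .inl ⟨?_, (h2.comp hτ).congr' ?_, (h3.comp hτ).congr' ?_⟩
    · filter_upwards [hs, hτ.eventually h1] with n hn hn'
      rwa [hn]
    · filter_upwards [hs] with n hn
      simp [hn]
    · filter_upwards [hs] with n hn
      simp [hn]
  · refine .inr ⟨a ∘ τ, ?_, h.comp_tendsto hτ⟩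
    filter_upwards [hs, hτ.eventually ha] with n hn hn'
    rw [hn]
    exact hn'

theorem exists_subseq [CompactSpace Y] [TopologicalSpace.MetrizableSpace Y]
    (hA : IsConvergenceAction A Y) (hs : Tendsto s atTop cofinite) :
    ∃ σ : ℕ → ℕ, StrictMono σ ∧ ∃ ξ η : Y, CosetLimit j P (s ∘ σ) ξ η := by
  by_cases h : ∃ᶠ n in atTop, s n ∉ j.range
  · obtain ⟨φ, hφ, hφs⟩ := extraction_of_frequently_atTop h
    obtain ⟨⟨ξ, η⟩, -, ψ, hψ, hlim⟩ := (isCompact_univ (X := Y × Y)).tendsto_subseq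
      (x := fun n => (P (s (φ n)), P (s (φ n))⁻¹)) fun n => Set.mem_univ _
    rw [nhds_prod_eq] at hlim
    exact ⟨φ ∘ ψ, hφ.comp hψ, ξ, η, .inl ⟨.of_forall fun n => hφs _,
      tendsto_fst.comp hlim, tendsto_snd.comp hlim⟩⟩
  · rw [not_frequently] at h
    simp only [not_not] at h
    have h' : ∀ᶠ n in atTop, ∃ a, j a = s n := h
    obtain ⟨φ, hφ, hφs⟩ := extraction_of_eventually_atTop h'
    choose a ha using hφs
    have hcof : Tendsto a atTop cofinite := by
      have h1 : Tendsto (j ∘ a) atTop cofinite := by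
        simpa only [Function.comp_def, ha] using hs.comp hφ.tendsto_atTop
      refine le_cofinite_iff_eventually_ne.2 fun x => ?_
      have h2 := h1.eventually (eventually_cofinite_ne (j x))
      rw [eventually_map]
      filter_upwards [h2] with n hn hx
      exact hn (by simp [hx])
    obtain ⟨σ, hσ, ξ, η, h⟩ := hA.exists_subseq_of_tendsto_cofinite hcof
    exact ⟨φ ∘ σ, hφ.comp hσ, ξ, η, .inr ⟨a ∘ σ, .of_forall fun n => (ha _).symm, h⟩⟩

end CosetLimit
end Combination

/-! ### Independence of the limits and the convergence property of the combination space. -/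

section CombinationConvergence

variable {G A Y : Type*} [Group G] [Group A] [MulAction A Y] [TopologicalSpace Y]
  {j : A →* G} {P : G → Y}

namespace IsCosetProjection

/-- On a two-point space the attracting point can be ambiguous. The element `g₀` provides a
parabolic point, so `Y` is a single point or has a third point on which to test both limits. -/
theorem attracting_unique [T2Space Y] (hP : IsCosetProjection j P) {g₀ : G} (hg₀ : g₀ ∉ j.range)
    {a : ℕ → A} {ξ ξ' η η' : Y} (h : ConvergesAway a ξ η) (h' : ConvergesAway a ξ' η') :
    ξ = ξ' := by
  by_cases hx : ∃ x, x ≠ P g₀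
  · obtain ⟨x, hx⟩ := hx
    obtain ⟨z, hz, hz'⟩ := (hP.parabolic g₀ hg₀).exists_ne_ne hx η η'
    exact tendsto_nhds_unique (h.tendsto hz) (h'.tendsto hz')
  · push Not at hx
    rw [hx ξ, hx ξ']

theorem cosetLimit_unique [T2Space Y] (hP : IsCosetProjection j P) {g₀ : G} (hg₀ : g₀ ∉ j.range)
    {s : ℕ → G} {ξ ξ' η η' : Y} (h : CosetLimit j P s ξ η) (h' : CosetLimit j P s ξ' η')
    (hj : Function.Injective j) : ξ = ξ' := by
  rcases h with ⟨h1, h2, -⟩ | ⟨a, ha, h⟩ <;> rcases h' with ⟨h1', h2', -⟩ | ⟨a', ha', h'⟩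
  · exact tendsto_nhds_unique h2 h2'
  · obtain ⟨n, hn, hn'⟩ := (h1.and ha').exists
    exact absurd ⟨_, hn'.symm⟩ hn
  · obtain ⟨n, hn, hn'⟩ := (h1'.and ha).exists
    exact absurd ⟨_, hn'.symm⟩ hn
  · refine hP.attracting_unique hg₀ h (h'.congr ?_)
    filter_upwards [ha, ha'] with n hn hn'
    exact hj (hn'.symm.trans hn)

theorem attracting_eq_of_eventually_mem [CompactSpace Y] [TopologicalSpace.MetrizableSpace Y]
    (hP : IsCosetProjection j P) (hj : Function.Injective j) (hA : IsConvergenceAction A Y) {g₀ : G}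
    (hg₀ : g₀ ∉ j.range) {s : ℕ → G} {a : ℕ → A} {ξ ξ' η η' : Y} {u : G}
    (ha : ∀ᶠ n in atTop, s n = j (a n)) (h : ConvergesAway a ξ η)
    (h' : CosetLimit j P (fun n => s n * u) ξ' η') : ξ' = ξ := by
  have := hA.continuousConstSMul
  by_cases hu : u ∈ j.range
  · obtain ⟨b, rfl⟩ := hu
    refine (hP.cosetLimit_unique hg₀ (.inr ⟨_, ?_, h.mul_right b⟩) h' hj).symm
    filter_upwards [ha] with n hn
    simp [hn]
  · have hnot : ∀ᶠ n in atTop, s n * u ∉ j.range := by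
      filter_upwards [ha] with n hn
      rwa [hn, Subgroup.mul_mem_cancel_left _ (MonoidHom.mem_range.2 ⟨_, rfl⟩)]
    rcases h' with ⟨-, hlim, -⟩ | ⟨b, hb, -⟩
    · have hlim' : Tendsto (fun n => a n • P u) atTop (𝓝 ξ) := by
        -- The points `P (s n * u)` are `a n • P u`. Only when `P u` is the repelling point is
        -- something deeper needed: parabolic points are not conical.
        by_cases hη : P u = η
        · rw [hη]
          exact (hη ▸ hP.parabolic u hu : IsParabolicPoint A η).tendsto_of_convergesAway hA h
        · exact h.tendsto hη
      refine tendsto_nhds_unique (hlim.congr' ?_) hlim'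
      filter_upwards [ha] with n hn
      rw [hn, hP.map_mul _ _ hu]
    · obtain ⟨n, hn, hn'⟩ := (hnot.and hb).exists
      exact absurd ⟨_, hn'.symm⟩ hn

/-- The attracting points seen from a fixed coset do not depend on the coset that is moved. -/
theorem attracting_eq [CompactSpace Y] [TopologicalSpace.MetrizableSpace Y]
    (hP : IsCosetProjection j P) (hj : Function.Injective j) (hA : IsConvergenceAction A Y) {g₀ : G}
    (hg₀ : g₀ ∉ j.range) {s : ℕ → G} {ξ η : G → Y}
    (h : ∀ w, CosetLimit j P (fun n => s n * w) (ξ w) (η w)) (w w' : G) : ξ w = ξ w' := by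
  by_cases hbad : ∃ (w₀ : G) (a : ℕ → A), (∀ᶠ n in atTop, s n * w₀ = j (a n)) ∧
      ConvergesAway a (ξ w₀) (η w₀)
  · obtain ⟨w₀, a, ha, hconv⟩ := hbad
    have key : ∀ w, ξ w = ξ w₀ := fun w =>
      hP.attracting_eq_of_eventually_mem hj hA hg₀ (u := w₀⁻¹ * w) ha hconv (by
        simpa [mul_assoc] using h w)
    rw [key w, key w']
  · have hgood : ∀ w, (∀ᶠ n in atTop, s n * w ∉ j.range) ∧
        Tendsto (fun n => P (s n * w)) atTop (𝓝 (ξ w)) := by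
      intro w
      rcases h w with ⟨h1, h2, -⟩ | ⟨a, ha, hconv⟩
      · exact ⟨h1, h2⟩
      · exact absurd ⟨w, a, ha, hconv⟩ hbad
    -- The directions of `s n * w` and `s n * w'` can differ only if some `s n * (w * t)`, with `t`
    -- in a finite set, lies in the image of `A`, which eventually never happens in this case.
    obtain ⟨T, hT, hTP⟩ := hP.finite_ne (w⁻¹ * w')
    refine tendsto_nhds_unique ((hgood w).2.congr' ?_) (hgood w').2
    have hev : ∀ᶠ n in atTop, ∀ t ∈ T, s n * (w * t) ∉ j.range :=
      (eventually_all_finite hT).2 fun t _ => (hgood (w * t)).1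
    filter_upwards [hev, (hgood w).1, (hgood w').1] with n hn hn1 hn2
    by_contra hne
    obtain ⟨t, ht, hmem⟩ := hTP (s n * w)⁻¹ (by rwa [Subgroup.inv_mem_iff])
      (by simpa [mul_assoc] using hn2) (by simpa [mul_assoc] using hne)
    exact hn t ht (by simpa [mul_assoc] using hmem)

/-- This is `eq_or_eq` in the limit: if `P (s n) = P x` infinitely often, the first limit is `P x`;
otherwise `P (x⁻¹ * s n)` is eventually `P x⁻¹`. If `s n` stays in the image of `A`, or in its coset
by `x`, one projection is constant. -/
theorem eq_or_eq_of_cosetLimit [T2Space Y] (hP : IsCosetProjection j P)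
    {s : ℕ → G} {ξ ξ' η η' : Y} {x : G} (hx : x ∉ j.range) (h : CosetLimit j P s ξ η)
    (h' : CosetLimit j P (fun n => x⁻¹ * s n) ξ' η') : ξ = P x ∨ ξ' = P x⁻¹ := by
  have hx' : x⁻¹ ∉ j.range := by rwa [Subgroup.inv_mem_iff]
  rcases h with ⟨h1, h2, -⟩ | ⟨a, ha, h⟩
  · rcases h' with ⟨h1', h2', -⟩ | ⟨a', ha', h'⟩
    · by_cases hfreq : ∃ᶠ n in atTop, P x = P (s n)
      · left
        exact (isClosed_singleton.mem_of_frequently_of_tendsto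
          (hfreq.mono fun n hn => hn.symm) h2 : ξ ∈ ({P x} : Set Y))
      · right
        rw [not_frequently] at hfreq
        refine tendsto_nhds_unique h2' (tendsto_const_nhds.congr' ?_)
        filter_upwards [hfreq, h1, h1'] with n hn hn1 hn2
        exact (hP.eq_or_eq x (s n) hx hn1 hn2).resolve_left hn
    · left
      refine tendsto_nhds_unique h2 (tendsto_const_nhds.congr' ?_)
      filter_upwards [ha'] with n hn
      rw [← hP.mul_map x (a' n) hx, ← hn, mul_inv_cancel_left]
  · right
    rcases h' with ⟨-, h2', -⟩ | ⟨a', ha', -⟩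
    · refine tendsto_nhds_unique h2' (tendsto_const_nhds.congr' ?_)
      filter_upwards [ha] with n hn
      rw [hn, hP.mul_map _ _ hx']
    · obtain ⟨n, hn, hn'⟩ := (ha.and ha').exists
      simp only [hn] at hn'
      exact absurd ((Subgroup.mul_mem_cancel_right _ (MonoidHom.mem_range.2 ⟨_, rfl⟩)).1 ⟨_, hn'.symm⟩) hx'

end IsCosetProjection

namespace CombinationSpace

/-- Consistency of `f` between `(γ n)⁻¹ * x` and `w` leaves two options: either `(γ n • f) x` is the
direction `P (x⁻¹ * γ n * w)`, which tends to `ξ`, or `f w` is a direction tending to `η`, which `F`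
excludes. -/
theorem tendsto_smul_apply [T2Space Y] [CompactSpace Y] {γ : ℕ → G} {x w : G} {ξ η : Y}
    (h : CosetLimit j P (fun n => x⁻¹ * γ n * w) ξ η) {K : Set (CombinationSpace j P)} {F : Set Y}
    (hF : IsClosed F) (hηF : η ∉ F) (hK : ∀ f ∈ K, f.1 w ∈ F) :
    Tendsto (fun p : ℕ × CombinationSpace j P => (γ p.1 • p.2).1 x) (atTop ×ˢ 𝓟 K) (𝓝 ξ) := by
  intro U hU
  refine mem_map.2 (eventually_prod_principal_iff.2 ?_)
  rcases h with ⟨h1, h2, h3⟩ | ⟨a, ha, h⟩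
  · filter_upwards [h1, h2.eventually_mem hU, h3.eventually_mem (hF.isOpen_compl.mem_nhds hηF)]
      with n hn1 hn2 hn3 f hf
    have h4 := f.2.2 ((γ n)⁻¹ * x) w
    simp only [mul_inv_rev, inv_inv] at h4 hn3
    rcases h4 hn1 with h5 | h5
    · rw [smul_apply, h5]
      exact hn2
    · exact absurd (h5 ▸ hK f hf) hn3
  · filter_upwards [ha, h F hF.isCompact hηF U hU] with n hn hn' f hf
    have h4 : (γ n)⁻¹ * x = w * j (a n)⁻¹ := by
      rw [map_inv, ← hn]
      group
    rw [smul_apply, h4, f.2.1, inv_inv]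
    exact hn' _ (hK f hf)

theorem exists_cosetLimits [Countable G] [CompactSpace Y] [TopologicalSpace.MetrizableSpace Y]
    (P : G → Y) (hA : IsConvergenceAction A Y) {g : ℕ → G} (hg : Function.Injective g) :
    ∃ σ : ℕ → ℕ, StrictMono σ ∧ ∀ x w, ∃ ξ η,
      CosetLimit j P (fun n => x⁻¹ * g (σ n) * w) ξ η := by
  obtain ⟨e, he⟩ := exists_surjective_nat (G × G)
  obtain ⟨σ, hσ, h⟩ := exists_strictMono_forall
    (Q := fun k σ => ∃ ξ η, CosetLimit j P (fun n => (e k).1⁻¹ * g (σ n) * (e k).2) ξ η)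
    (fun k σ hσ => by
      refine CosetLimit.exists_subseq (s := fun n => (e k).1⁻¹ * g (σ n) * (e k).2) hA ?_
      have hinj : Function.Injective fun n => (e k).1⁻¹ * g (σ n) * (e k).2 := fun m n hmn =>
        hσ.injective (hg (mul_left_cancel (mul_right_cancel hmn)))
      have := hinj.tendsto_cofinite
      rwa [Nat.cofinite_eq_atTop] at this)
    (fun k σ τ ρ => by
      rintro ⟨ξ, η, h⟩ hτ hρ
      exact ⟨ξ, η, h.comp_tendsto hτ (hρ.mono fun n hn => by simp [hn])⟩)
  refine ⟨σ, hσ, fun x w => ?_⟩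
  obtain ⟨k, hk⟩ := he (x, w)
  have := h k
  rwa [hk] at this

theorem isConvergenceAction [Countable G] [CompactSpace Y] [TopologicalSpace.MetrizableSpace Y]
    (hP : IsCosetProjection j P) (hj : Function.Injective j) (hA : IsConvergenceAction A Y) {g₀ : G}
    (hg₀ : g₀ ∉ j.range) : IsConvergenceAction G (CombinationSpace j P) := by
  have := hA.continuousConstSMul
  refine ⟨continuous_smul, fun g hg => ?_⟩
  obtain ⟨σ, hσ, h⟩ := exists_cosetLimits (j := j) P hA hg
  choose ξ η h using h
  have hinv : ∀ w x, CosetLimit j P (fun n => w⁻¹ * (g (σ n))⁻¹ * x) (η x w) (ξ x w) := fun w x => by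
    have := (h x w).inv
    simpa [mul_assoc] using this
  have hξ : ∀ x w w', ξ x w = ξ x w' := fun x =>
    hP.attracting_eq hj hA hg₀ (h x)
  have hη : ∀ w x x', η x w = η x' w := fun w =>
    hP.attracting_eq hj hA hg₀ (hinv w)
  -- Equivariance and consistency survive in the limit, so the limiting families are themselves
  -- points of the space.
  have hmem : ∀ (γ : ℕ → G) (ξ η : G → Y), (∀ x, CosetLimit j P (fun n => x⁻¹ * γ n) (ξ x) (η x)) →
      ξ ∈ CombinationSpace j P := by
    intro γ ξ η h
    refine ⟨fun x a => ?_, fun x y hxy => ?_⟩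
    · refine hP.cosetLimit_unique hg₀ (h (x * j a)) (η' := η x) ?_ hj
      rcases h x with ⟨h1, h2, h3⟩ | ⟨b, hb, hconv⟩
      · refine .inl ⟨?_, ?_, ?_⟩
        · filter_upwards [h1] with n hn
          rwa [mul_inv_rev, ← map_inv, mul_assoc, Subgroup.mul_mem_cancel_left _ (MonoidHom.mem_range.2 ⟨_, rfl⟩)]
        · refine ((continuous_const_smul a⁻¹).continuousAt.tendsto.comp h2).congr' ?_
          filter_upwards [h1] with n hn
          rw [mul_inv_rev, ← map_inv, mul_assoc, hP.map_mul _ _ hn]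
          rfl
        · refine h3.congr' ?_
          filter_upwards [h1] with n hn
          rw [mul_inv_rev (x * j a)⁻¹, inv_inv, ← mul_assoc, hP.mul_map, mul_inv_rev, inv_inv]
          rwa [← Subgroup.inv_mem_iff, mul_inv_rev, inv_inv]
      · refine .inr ⟨fun n => a⁻¹ * b n, ?_, hconv.mul_left a⁻¹⟩
        filter_upwards [hb] with n hn
        rw [mul_inv_rev, mul_assoc, hn, map_mul, map_inv]
    · have := hP.eq_or_eq_of_cosetLimit hxy (h x) (ξ' := ξ y) (η' := η y) (by
        simpa [mul_assoc] using h y)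
      simpa using this
  refine ⟨σ, hσ, ⟨fun x => ξ x 1, hmem (g ∘ σ) _ (fun x => η x 1) fun x => by simpa using h x 1⟩,
    ⟨fun w => η 1 w, hmem (fun n => (g (σ n))⁻¹) _ (fun w => ξ 1 w) fun w => by
      simpa using hinv w 1⟩, fun K hK hηK => ?_⟩
  suffices hsuff : ∀ x, Tendsto (fun p : ℕ × CombinationSpace j P => (g (σ p.1) • p.2).1 x)
      (atTop ×ˢ 𝓟 K) (𝓝 (ξ x 1)) by
    have hlim : Tendsto (fun p : ℕ × CombinationSpace j P => (g (σ p.1) • p.2))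
        (atTop ×ˢ 𝓟 K) (𝓝 ⟨fun x => ξ x 1, hmem (g ∘ σ) _ (fun x => η x 1) fun x => by
          simpa using h x 1⟩) := tendsto_subtype_rng.2 (tendsto_pi_nhds.2 hsuff)
    exact fun U hU => eventually_prod_principal_iff.1 (hlim.eventually_mem hU)
  intro x
  -- Uniformity on `K` is local: each `f ∈ K` differs from the repelling family at some `w`, and so
  -- do all families near it. Independence of `w` lets this coordinate control the limit at `x`.
  refine hK.induction_on (p := fun K => Tendsto (fun p : ℕ × CombinationSpace j P =>
    (g (σ p.1) • p.2).1 x) (atTop ×ˢ 𝓟 K) (𝓝 (ξ x 1))) (by simp) (fun s t hst ht => ?_)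
    (fun s t hs ht => ?_) (fun f hf => ?_)
  · exact ht.mono_left (prod_mono_right _ (principal_mono.2 hst))
  · rw [← sup_principal, prod_sup]
    exact hs.sup ht
  · obtain ⟨w, hw⟩ : ∃ w, f.1 w ≠ η 1 w := by
      by_contra! hcon
      refine hηK (Eq.mp (congrArg (· ∈ K) ?_) hf)
      exact Subtype.ext (funext hcon)
    obtain ⟨V, W, hV, hW, hfV, hηW, hVW⟩ := t2_separation hw
    refine ⟨{f | f.1 w ∈ V}, mem_nhdsWithin_of_mem_nhds
      ((hV.preimage (continuous_eval w)).mem_nhds hfV), ?_⟩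
    rw [hξ x 1 w]
    exact tendsto_smul_apply (h x w) hW.isClosed_compl
      (by rw [hη w x 1]; simpa using hηW) fun f hf hfW => hVW.ne_of_mem hf hfW rfl

theorem exists_apply_one_eq [ContinuousConstSMul A Y] (hP : IsCosetProjection j P)
    (hj : Function.Injective j) (y : Y) : ∃ f : CombinationSpace j P, f.1 1 = y := by
  classical
  -- From any other translate, a point of the base translate is seen in the direction of the base.
  let f : G → Y := fun x => if h : x ∈ j.range then h.choose⁻¹ • y else P x⁻¹
  have hf : ∀ a, f (j a) = a⁻¹ • y := fun a => by
    have h : j a ∈ j.range := ⟨a, rfl⟩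
    simp only [f, dif_pos h]
    rw [hj h.choose_spec]
  have hf' : ∀ x, x ∉ j.range → f x = P x⁻¹ := fun x hx => dif_neg hx
  refine ⟨⟨f, fun x a => ?_, fun x z hxz => ?_⟩, ?_⟩
  · by_cases hx : x ∈ j.range
    · obtain ⟨b, rfl⟩ := hx
      rw [← map_mul, hf, hf, mul_inv_rev, mul_smul]
    · have hx' : x⁻¹ ∉ j.range := by rwa [Subgroup.inv_mem_iff]
      rw [hf' x hx, hf', mul_inv_rev, ← map_inv, hP.map_mul _ _ hx']
      rwa [Subgroup.mul_mem_cancel_right _ (MonoidHom.mem_range.2 ⟨_, rfl⟩)]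
  · by_cases hx : x ∈ j.range
    · have hz : z ∉ j.range := fun hz => hxz (mul_mem (inv_mem hx) hz)
      obtain ⟨b, rfl⟩ := hx
      right
      rw [hf' z hz, hP.mul_map]
      rwa [Subgroup.inv_mem_iff]
    · have hx' : x⁻¹ ∉ j.range := by rwa [Subgroup.inv_mem_iff]
      by_cases hz : z ∈ j.range
      · obtain ⟨b, rfl⟩ := hz
        left
        rw [hf' x hx, hP.mul_map _ _ hx']
      · have hz' : z⁻¹ ∉ j.range := by rwa [Subgroup.inv_mem_iff]
        rw [hf' x hx, hf' z hz]
        have h1 := hP.eq_or_eq (x⁻¹ * z) x⁻¹ hxz hx' (by simpa using hz')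
        simp only [mul_inv_rev, inv_inv, mul_assoc, mul_inv_cancel, mul_one] at h1
        exact h1.imp Eq.symm Eq.symm
  · simpa using hf 1

/-- Lift a sequence of `A` to `G` and extract a limit there. A family through a point `y` that
avoids both repelling points converges under both actions, and evaluation at `1` matches the two
limits; this is why `Y` needs a third point. -/
theorem limitSet_subset_image [Countable G] [CompactSpace Y] [TopologicalSpace.MetrizableSpace Y]
    (hP : IsCosetProjection j P) (hj : Function.Injective j) (hA : IsConvergenceAction A Y) {g₀ : G}
    (hg₀ : g₀ ∉ j.range) (hY : ∀ y z : Y, ∃ x, x ≠ y ∧ x ≠ z) :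
    limitSet Y (⊤ : Subgroup A) ⊆
      (fun f : CombinationSpace j P => f.1 1) '' limitSet (CombinationSpace j P) (⊤ : Subgroup G) := by
  have := hA.continuousConstSMul
  rintro ξ ⟨a, ha, -, η, h⟩
  obtain ⟨σ, hσ, ζ, θ, hζ⟩ := (isConvergenceAction hP hj hA hg₀).exists_subseq (j ∘ a) (hj.comp ha)
  refine ⟨ζ, ⟨_, (hj.comp ha).comp hσ.injective, fun _ => Subgroup.mem_top _, θ, hζ⟩, ?_⟩
  obtain ⟨y, hyη, hyθ⟩ := hY η (θ.1 1)
  obtain ⟨f, hf⟩ := exists_apply_one_eq hP hj y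
  have h1 := hζ.tendsto (x := f) fun hfθ => hyθ (by rw [← hf, hfθ])
  refine tendsto_nhds_unique (((continuous_eval 1).tendsto ζ).comp h1) ?_
  refine ((h.comp_tendsto hσ.tendsto_atTop).tendsto hyη).congr fun n => ?_
  simp only [Function.comp_apply, smul_apply, ← map_inv, mul_one]
  rw [← one_mul (j (a (σ n))⁻¹), f.2.1, hf, inv_inv]

theorem exists_convergenceAction {G A Y : Type u} [Group G] [Countable G] [Group A]
    [MulAction A Y] [TopologicalSpace Y] [CompactSpace Y] [TopologicalSpace.MetrizableSpace Y]
    {j : A →* G} {P : G → Y} (hP : IsCosetProjection j P) (hj : Function.Injective j)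
    (hA : IsConvergenceAction A Y) {g₀ : G} (hg₀ : g₀ ∉ j.range) :
    IsConvergenceGroup G ∧
      (2 < (limitSet Y (⊤ : Subgroup A)).encard → IsNonelementaryConvergenceGroup G) := by
  have := hA.continuousConstSMul
  have hconv := isConvergenceAction hP hj hA hg₀
  refine ⟨⟨CombinationSpace j P, inferInstance, inferInstance, compactSpace, metrizableSpace, hconv⟩,
    fun h => ⟨CombinationSpace j P, inferInstance, inferInstance, compactSpace, metrizableSpace,
      hconv, h.trans_le ?_⟩⟩
  refine (Set.encard_le_encard (limitSet_subset_image hP hj hA hg₀ fun y z => ?_)).trans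
    (Set.encard_image_le _ _)
  by_contra! hcon
  have hsub : limitSet Y (⊤ : Subgroup A) ⊆ {y, z} := fun x _ => by
    by_cases hx : x = y
    · exact .inl hx
    · exact .inr (hcon x hx)
  exact absurd ((Set.encard_le_encard hsub).trans ((Set.encard_insert_le _ _).trans (by
    rw [Set.encard_singleton, one_add_one_eq_two]))) (not_le.2 h)

end CombinationSpace
end CombinationConvergence

/-! ## Closed images of compact metrizable spaces -/

section ClosedImage

variable {X Y : Type*} [TopologicalSpace X] [TopologicalSpace Y] {f : X → Y}

theorem IsClosedMap.t2Space_of_normal [NormalSpace X] [T1Space X] (hf : IsClosedMap f)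
    (hc : Continuous f) (hs : Function.Surjective f) : T2Space Y := by
  refine ⟨fun y z hyz => ?_⟩
  have hcl : ∀ y, IsClosed (f ⁻¹' {y}) := fun y => by
    obtain ⟨x, rfl⟩ := hs y
    rw [← Set.image_singleton]
    exact (hf _ isClosed_singleton).preimage hc
  obtain ⟨U, V, hU, hV, hyU, hzV, hUV⟩ := NormalSpace.normal _ _ (hcl y) (hcl z)
    ((Set.disjoint_singleton.2 hyz).preimage f)
  refine ⟨Set.kernImage f U, Set.kernImage f V, isClosedMap_iff_kernImage.1 hf hU,
    isClosedMap_iff_kernImage.1 hf hV, fun x hx => hyU hx, fun x hx => hzV hx, ?_⟩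
  refine Set.disjoint_left.2 fun w hwU hwV => ?_
  obtain ⟨x, rfl⟩ := hs w
  exact hUV.ne_of_mem (hwU rfl) (hwV rfl) rfl

/-- A fibre is compact, so finitely many basic open sets cover it inside a given neighbourhood.
Hence the sets `Set.kernImage` of finite unions form a countable basis. -/
theorem IsClosedMap.secondCountableTopology [CompactSpace X] [SecondCountableTopology X]
    [T1Space Y] (hf : IsClosedMap f) (hc : Continuous f) (hs : Function.Surjective f) :
    SecondCountableTopology Y := by
  obtain ⟨B, hBc, -, hB⟩ := TopologicalSpace.exists_countable_basis X
  let C : Set (Set Y) := (fun S : Set (Set X) => Set.kernImage f (⋃₀ S)) '' {S | S.Finite ∧ S ⊆ B}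
  have hC : C.Countable := (Set.countable_ofPred_finite_subset hBc).image _
  refine (TopologicalSpace.isTopologicalBasis_of_isOpen_of_nhds (s := C) ?_ ?_).secondCountableTopology hC
  · rintro _ ⟨S, ⟨-, hSB⟩, rfl⟩
    exact isClosedMap_iff_kernImage.1 hf (isOpen_sUnion fun s hs => hB.isOpen (hSB hs))
  · intro y V hy hV
    have hcomp : IsCompact (f ⁻¹' {y}) := (isClosed_singleton.preimage hc).isCompact
    have hsub : f ⁻¹' {y} ⊆ ⋃ s ∈ {s | s ∈ B ∧ s ⊆ f ⁻¹' V}, id s := by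
      intro x hx
      obtain ⟨s, hs, hxs, hsV⟩ := hB.exists_subset_of_mem_open
        (show x ∈ f ⁻¹' V by rw [Set.mem_preimage, Set.mem_singleton_iff.1 hx]; exact hy)
        (hV.preimage hc)
      exact Set.mem_biUnion (show s ∈ {s | s ∈ B ∧ s ⊆ f ⁻¹' V} from ⟨hs, hsV⟩) hxs
    obtain ⟨T, hT, hTf, hTc⟩ := hcomp.elim_finite_subcover_image
      (fun s hs => hB.isOpen hs.1) hsub
    refine ⟨_, ⟨T, ⟨hTf, fun s hs => (hT hs).1⟩, rfl⟩, fun x hx => ?_, fun z hz => ?_⟩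
    · rw [Set.sUnion_eq_biUnion]
      exact hTc hx
    · obtain ⟨x, rfl⟩ := hs z
      obtain ⟨s, hs, hxs⟩ := hz rfl
      exact (hT hs).2 hxs

end ClosedImage

/-! ## Collapsing the translates of limit sets -/

theorem ConvergesAway.map {A X Y : Type*} [Group A] [TopologicalSpace X] [MulAction A X]
    [TopologicalSpace Y] [MulAction A Y] [CompactSpace X] [T2Space Y] {f : X → Y}
    (hc : Continuous f) (hs : Function.Surjective f) (hf : ∀ (a : A) (x : X), f (a • x) = a • f x)
    {g : ℕ → A} {ξ η : X} (h : ConvergesAway g ξ η) : ConvergesAway g (f ξ) (f η) := by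
  intro K hK hη U hU
  filter_upwards [h (f ⁻¹' K) (hK.isClosed.preimage hc).isCompact hη _ (hc.continuousAt hU)]
    with n hn y hy
  obtain ⟨x, rfl⟩ := hs y
  rw [← hf]
  exact hn x hy

section Collapse

variable {A X ι : Type*} [Group A] [TopologicalSpace X] [MulAction A X] {H : ι → Subgroup A}

theorem IsDynamicallyMalnormalFamily.eq_and_mem (hmal : IsDynamicallyMalnormalFamily X H) {a b : A}
    {i k : ι} {x : X} (hx : x ∈ a • limitSet X (H i)) (hx' : x ∈ b • limitSet X (H k)) :
    i = k ∧ b⁻¹ * a ∈ H i := by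
  by_contra hcon
  rw [Set.mem_smul_set_iff_inv_smul_mem] at hx hx'
  refine (hmal.2 (b⁻¹ * a) i k hcon).ne_of_mem (a := b⁻¹ • x) (b := b⁻¹ • x) ?_ hx' rfl
  rw [Set.mem_smul_set_iff_inv_smul_mem]
  simpa [mul_smul] using hx

theorem IsDynamicallyMalnormalFamily.smul_limitSet_eq [ContinuousConstSMul A X]
    (hmal : IsDynamicallyMalnormalFamily X H) {a b : A} {i k : ι} {x : X}
    (hx : x ∈ a • limitSet X (H i)) (hx' : x ∈ b • limitSet X (H k)) :
    a • limitSet X (H i) = b • limitSet X (H k) := by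
  obtain ⟨rfl, h⟩ := hmal.eq_and_mem hx hx'
  have := _root_.smul_limitSet_eq (X := X) h
  rw [mul_smul, inv_smul_eq_iff] at this
  exact this

/-- The relation that collapses every translate of a limit set of the family to a point. -/
def collapseSetoid [ContinuousConstSMul A X] (hmal : IsDynamicallyMalnormalFamily X H) :
    Setoid X where
  r x y := x = y ∨ ∃ (a : A) (i : ι), x ∈ a • limitSet X (H i) ∧ y ∈ a • limitSet X (H i)
  iseqv := by
    refine ⟨fun x => .inl rfl, ?_, ?_⟩
    · rintro x y (rfl | ⟨a, i, hx, hy⟩)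
      · exact .inl rfl
      · exact .inr ⟨a, i, hy, hx⟩
    · rintro x y z (rfl | ⟨a, i, hx, hy⟩) (rfl | ⟨b, k, hy', hz⟩)
      · exact .inl rfl
      · exact .inr ⟨b, k, hy', hz⟩
      · exact .inr ⟨a, i, hx, hy⟩
      · exact .inr ⟨a, i, hx, by rwa [hmal.smul_limitSet_eq hy hy']⟩

theorem collapseSetoid_smul [ContinuousConstSMul A X] (hmal : IsDynamicallyMalnormalFamily X H)
    (a : A) {x y : X} (h : collapseSetoid hmal x y) : collapseSetoid hmal (a • x) (a • y) := by
  rcases h with rfl | ⟨b, i, hx, hy⟩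
  · exact .inl rfl
  · refine .inr ⟨a * b, i, ?_, ?_⟩
    · rw [mul_smul]
      exact Set.smul_mem_smul_set hx
    · rw [mul_smul]
      exact Set.smul_mem_smul_set hy

/-- Near a pair of inequivalent points with disjoint closed neighbourhoods `K`, `L`, quasi-convexity
leaves finitely many translates meeting both. Their squares are closed and miss the pair. -/
theorem isClosed_collapseSetoid [ContinuousConstSMul A X] [CompactSpace X]
    [TopologicalSpace.MetrizableSpace X] [Finite ι] (hmal : IsDynamicallyMalnormalFamily X H)
    (hqc : ∀ i, IsDynamicallyQuasiconvex X (H i)) :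
    IsClosed {p : X × X | collapseSetoid hmal p.1 p.2} := by
  rw [← isOpen_compl_iff, isOpen_iff_mem_nhds]
  rintro ⟨x, y⟩ hxy
  have hne : x ≠ y := fun h => hxy (.inl h)
  obtain ⟨U, V, hU, hV, hUV⟩ := t2_separation_nhds hne
  obtain ⟨K, hxK, hK, hKU⟩ := exists_mem_nhds_isClosed_subset hU
  obtain ⟨L, hyL, hL, hLV⟩ := exists_mem_nhds_isClosed_subset hV
  have hfin := fun i => hqc i K L hK hL (hUV.mono hKU hLV)
  set S := fun i => {c : A ⧸ H i | ∃ g : A, (g : A ⧸ H i) = c ∧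
    ((g • limitSet X (H i)) ∩ K).Nonempty ∧ ((g • limitSet X (H i)) ∩ L).Nonempty} with hS
  set D : Set (X × X) := ⋃ i, ⋃ c ∈ S i,
    (c.out • limitSet X (H i)) ×ˢ (c.out • limitSet X (H i)) with hD
  have hDcl : IsClosed D := isClosed_iUnion_of_finite fun i => (hfin i).isClosed_biUnion fun c _ =>
    ((isClosed_limitSet (H i)).smul c.out).prod ((isClosed_limitSet (H i)).smul c.out)
  have hxyD : (x, y) ∉ D := by
    intro h
    simp only [hD, Set.mem_iUnion, Set.mem_prod] at h
    obtain ⟨i, c, -, h1, h2⟩ := h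
    exact hxy (.inr ⟨_, i, h1, h2⟩)
  filter_upwards [prod_mem_nhds hxK hyL, hDcl.isOpen_compl.mem_nhds hxyD]
  rintro ⟨x', y'⟩ ⟨hx', hy'⟩ hD' (heq | ⟨a, i, h1, h2⟩)
  · exact hUV.ne_of_mem (hKU hx') (hLV hy') heq
  · refine hD' ?_
    have hout : ((a : A ⧸ H i).out) • limitSet X (H i) = a • limitSet X (H i) := by
      obtain ⟨h, hh⟩ := QuotientGroup.mk_out_eq_mul (H i) a
      rw [hh, mul_smul, smul_limitSet_eq h.2]
    simp only [hD, Set.mem_iUnion, Set.mem_prod]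
    exact ⟨i, a, ⟨a, rfl, ⟨x', h1, hx'⟩, ⟨y', h2, hy'⟩⟩, by rwa [hout], by rwa [hout]⟩

theorem exists_collapse {A X : Type u} {ι : Type*} [Group A] [TopologicalSpace X] [MulAction A X]
    {H : ι → Subgroup A} [CompactSpace X] [TopologicalSpace.MetrizableSpace X] [Finite ι]
    (hA : IsConvergenceAction A X) (hmal : IsDynamicallyMalnormalFamily X H)
    (hqc : ∀ i, IsDynamicallyQuasiconvex X (H i)) :
    ∃ (Y : Type u) (_ : TopologicalSpace Y) (_ : MulAction A Y) (π : X → Y), CompactSpace Y ∧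
      TopologicalSpace.MetrizableSpace Y ∧ IsConvergenceAction A Y ∧ Continuous π ∧
      Function.Surjective π ∧ (∀ (a : A) (x : X), π (a • x) = a • π x) ∧
      ∀ x y, π x = π y ↔
        x = y ∨ ∃ (a : A) (i : ι), x ∈ a • limitSet X (H i) ∧ y ∈ a • limitSet X (H i) := by
  have := hA.continuousConstSMul
  let r := collapseSetoid hmal
  let _ : MulAction A (Quotient r) :=
    { smul := fun a => Quotient.map (a • ·) fun _ _ h => collapseSetoid_smul hmal a h
      one_smul := by
        rintro ⟨x⟩
        exact congrArg (Quotient.mk r) (one_smul A x)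
      mul_smul := by
        rintro a b ⟨x⟩
        exact congrArg (Quotient.mk r) (mul_smul a b x) }
  have hsmul : ∀ (a : A) (x : X), Quotient.mk r (a • x) = a • Quotient.mk r x := fun _ _ => rfl
  have hc : Continuous (Quotient.mk r) := continuous_quotient_mk'
  have hs : Function.Surjective (Quotient.mk r) := Quotient.mk_surjective
  have hcl : IsClosedMap (Quotient.mk r) := by
    intro C hC
    refine (isQuotientMap_quotient_mk' (s := r)).isClosed_preimage.1 ?_
    -- The saturation of a closed set is a projection of a compact part of the closed relation.
    have : Quotient.mk r ⁻¹' (Quotient.mk r '' C) =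
        Prod.snd '' ({p : X × X | r p.1 p.2} ∩ Prod.fst ⁻¹' C) := by
      ext y
      constructor
      · rintro ⟨x, hx, hxy⟩
        exact ⟨(x, y), ⟨Quotient.exact hxy, hx⟩, rfl⟩
      · rintro ⟨⟨x, _⟩, ⟨hxy, hx⟩, rfl⟩
        exact ⟨x, hx, Quotient.sound hxy⟩
    refine (congrArg IsClosed this).mpr ?_
    exact (((isClosed_collapseSetoid hmal hqc).inter
      (hC.preimage continuous_fst)).isCompact.image continuous_snd).isClosed
  have hT2 : T2Space (Quotient r) := hcl.t2Space_of_normal hc hs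
  have hsc : SecondCountableTopology (Quotient r) := hcl.secondCountableTopology hc hs
  refine ⟨Quotient r, inferInstance, inferInstance, Quotient.mk r, inferInstance, inferInstance,
    ⟨fun a => ?_, fun g hg => ?_⟩, hc, hs, hsmul, fun x y => Quotient.eq (r := r)⟩
  · exact (hc.comp (continuous_const_smul a)).quotient_lift _
  · obtain ⟨σ, hσ, ξ, η, h⟩ := hA.exists_subseq g hg
    refine ⟨σ, hσ, Quotient.mk r ξ, Quotient.mk r η, ConvergesAway.map hc hs hsmul h⟩

end Collapse

/-! ### Stabilizers, parabolic points and limit points after collapsing. -/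

section CollapseProperties

theorem Set.two_lt_encard_of_ne {α : Type*} {s : Set α} {x y z : α} (hx : x ∈ s) (hy : y ∈ s)
    (hz : z ∈ s) (hxy : x ≠ y) (hxz : x ≠ z) (hyz : y ≠ z) : 2 < s.encard := by
  have h3 : ({x, y, z} : Set α).encard = 3 := Set.encard_eq_three.2 ⟨x, y, z, hxy, hxz, hyz, rfl⟩
  have hsub : ({x, y, z} : Set α) ⊆ s := by
    rintro w (rfl | rfl | rfl) <;> assumption
  refine lt_of_lt_of_le ?_ (Set.encard_le_encard hsub)
  rw [h3]
  norm_num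

theorem limitSet_map_subset {A X Y : Type*} [Group A] [TopologicalSpace X] [MulAction A X]
    [TopologicalSpace Y] [MulAction A Y] [CompactSpace X] [T2Space Y] {π : X → Y}
    (hc : Continuous π) (hs : Function.Surjective π) (hf : ∀ (a : A) (x : X), π (a • x) = a • π x)
    (H : Subgroup A) {x : X} (hx : x ∈ limitSet X H) : π x ∈ limitSet Y H := by
  obtain ⟨g, hg, hgH, η, h⟩ := hx
  exact ⟨g, hg, hgH, π η, ConvergesAway.map hc hs hf h⟩

variable {A X Y ι : Type*} [Group A] [TopologicalSpace X] [MulAction A X]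
  {H : ι → Subgroup A} {π : X → Y}

theorem apply_eq_iff_mem_limitSet [ContinuousConstSMul A X]
    (hmal : IsDynamicallyMalnormalFamily X H)
    (hπ : ∀ x y, π x = π y ↔
      x = y ∨ ∃ (a : A) (i : ι), x ∈ a • limitSet X (H i) ∧ y ∈ a • limitSet X (H i))
    {i : ι} {c : X} (hci : c ∈ limitSet X (H i)) (x : X) : π x = π c ↔ x ∈ limitSet X (H i) := by
  have hci' : c ∈ (1 : A) • limitSet X (H i) := by rwa [one_smul]
  rw [hπ]
  constructor
  · rintro (rfl | ⟨a, k, hx, hc⟩)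
    · exact hci
    · rwa [hmal.smul_limitSet_eq hc hci', one_smul] at hx
  · intro hx
    exact .inr ⟨1, i, by rwa [one_smul], hci'⟩

variable [MulAction A Y]

theorem smul_apply_eq_iff_mem [ContinuousConstSMul A X]
    (hmal : IsDynamicallyMalnormalFamily X H) (hf : ∀ (a : A) (x : X), π (a • x) = a • π x)
    (hπ : ∀ x y, π x = π y ↔
      x = y ∨ ∃ (a : A) (i : ι), x ∈ a • limitSet X (H i) ∧ y ∈ a • limitSet X (H i))
    {i : ι} {c : X} (hci : c ∈ limitSet X (H i)) (a : A) : a • π c = π c ↔ a ∈ H i := by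
  rw [← hf, apply_eq_iff_mem_limitSet hmal hπ hci]
  refine ⟨fun h => ?_, fun h => smul_mem_limitSet h hci⟩
  have := (hmal.eq_and_mem (a := a) (b := 1) (i := i) (k := i) (Set.smul_mem_smul_set hci)
    (by rwa [one_smul])).2
  simpa using this

variable [TopologicalSpace Y]

/-- By malnormality the stabilizer of `π c` is exactly `H i`. Sequences in it have attracting and
repelling points in `Λ(H i)`, all of which collapses to `π c`. -/
theorem isParabolicPoint_of_collapse [CompactSpace X] [TopologicalSpace.MetrizableSpace X]
    [T2Space Y] (hA : IsConvergenceAction A X) (hmal : IsDynamicallyMalnormalFamily X H)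
    (hc : Continuous π) (hs : Function.Surjective π) (hf : ∀ (a : A) (x : X), π (a • x) = a • π x)
    (hπ : ∀ x y, π x = π y ↔
      x = y ∨ ∃ (a : A) (i : ι), x ∈ a • limitSet X (H i) ∧ y ∈ a • limitSet X (H i))
    {i : ι} [Infinite (H i)] {c : X} (hci : c ∈ limitSet X (H i)) : IsParabolicPoint A (π c) := by
  have := hA.continuousConstSMul
  have hstab := smul_apply_eq_iff_mem hmal hf hπ hci
  refine ⟨Infinite.of_injective (fun h : H i =>
    (⟨h, (hstab h).2 h.2⟩ : MulAction.stabilizer A (π c)))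
      fun h k hhk => Subtype.ext (congrArg (fun x => x.1) hhk), fun h hinj hfix => ?_⟩
  intro K hK hpK U hU
  by_contra hcon
  obtain ⟨φ, hφ, hφU⟩ := extraction_of_frequently_atTop (not_eventually.1 hcon)
  obtain ⟨σ, hσ, ξ, η, hlim⟩ := hA.exists_subseq (h ∘ φ) (hinj.comp hφ.injective)
  have hinj' : Function.Injective ((h ∘ φ) ∘ σ) := (hinj.comp hφ.injective).comp hσ.injective
  have hmem : ∀ n, ((h ∘ φ) ∘ σ) n ∈ H i := fun n => (hstab _).1 (hfix _)
  have hξ : π ξ = π c := (apply_eq_iff_mem_limitSet hmal hπ hci ξ).2 ⟨_, hinj', hmem, η, hlim⟩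
  have hη : π η = π c := (apply_eq_iff_mem_limitSet hmal hπ hci η).2
    (repelling_mem_limitSet hinj' hmem hlim)
  have := ConvergesAway.map hc hs hf hlim
  rw [hξ, hη] at this
  obtain ⟨n, hn⟩ := (this K hK hpK U hU).exists
  exact hφU _ hn

/-- With an empty family nothing is collapsed. Otherwise the orbit of `π c` consists of limit
points; if there were at most two, `H i` would have index two, hence be normal, and `g • Λ(H i) =
Λ(H i)` for `g ∉ H i` contradicts malnormality. -/
theorem two_lt_encard_limitSet_of_collapse [CompactSpace X]
    [TopologicalSpace.MetrizableSpace X] [T2Space Y] (hA : IsConvergenceAction A X)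
    (hmal : IsDynamicallyMalnormalFamily X H)
    (hc : Continuous π) (hs : Function.Surjective π) (hf : ∀ (a : A) (x : X), π (a • x) = a • π x)
    (hπ : ∀ x y, π x = π y ↔
      x = y ∨ ∃ (a : A) (i : ι), x ∈ a • limitSet X (H i) ∧ y ∈ a • limitSet X (H i))
    (hne : ∀ i, (limitSet X (H i)).Nonempty) (htop : ∀ i, H i ≠ ⊤)
    (h2 : 2 < (limitSet X (⊤ : Subgroup A)).encard) :
    2 < (limitSet Y (⊤ : Subgroup A)).encard := by
  have := hA.continuousConstSMul
  have himage : π '' limitSet X (⊤ : Subgroup A) ⊆ limitSet Y (⊤ : Subgroup A) := by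
    rintro _ ⟨x, hx, rfl⟩
    exact limitSet_map_subset hc hs hf _ hx
  rcases isEmpty_or_nonempty ι with hι | ⟨⟨i⟩⟩
  · have hinj : Function.Injective π := fun x y hxy => by
      rcases (hπ x y).1 hxy with h | ⟨a, i, -⟩
      · exact h
      · exact hι.elim i
    exact h2.trans_le ((hinj.encard_image _).symm.trans_le (Set.encard_le_encard himage))
  · by_contra hcon
    obtain ⟨c, hci⟩ := hne i
    have hstab := smul_apply_eq_iff_mem hmal hf hπ hci
    have hmemY : ∀ a : A, a • π c ∈ limitSet Y (⊤ : Subgroup A) := fun a => by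
      rw [← hf]
      exact himage ⟨_, smul_mem_limitSet (Subgroup.mem_top a) (limitSet_mono le_top hci), rfl⟩
    obtain ⟨g, hg⟩ : ∃ g, g ∉ H i := by
      by_contra! h
      exact htop i ((Subgroup.eq_top_iff' _).2 h)
    have hindex : ∀ k, k ∉ H i → g⁻¹ * k ∈ H i := by
      intro k hk
      by_contra hgk
      refine hcon (Set.two_lt_encard_of_ne (by simpa using hmemY 1) (hmemY g) (hmemY k)
        (fun h => hg ((hstab g).1 h.symm)) (fun h => hk ((hstab k).1 h.symm)) fun h => hgk ?_)
      rw [← hstab, mul_smul, ← h, inv_smul_smul]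
    obtain ⟨h, hinj, hH, η, hlim⟩ := hci
    refine (hmal.1 i g hg).ne_of_mem (Set.smul_mem_smul_set ⟨h, hinj, hH, η, hlim⟩)
      ⟨fun n => g * h n * g⁻¹, fun m n hmn => hinj (mul_left_cancel (mul_right_cancel hmn)),
        fun n => ?_, _, hlim.conj g⟩ rfl
    by_contra hnot
    have := hindex _ hnot
    simp only [mul_assoc, inv_mul_cancel_left] at this
    rw [Subgroup.mul_mem_cancel_left _ (hH n), Subgroup.inv_mem_iff] at this
    exact hg this

end CollapseProperties

/-- Collapsing the translates of the limit sets of a dynamically malnormal family of infinite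
dynamically quasi-convex subgroups yields a convergence action in which each of them fixes a
parabolic point. -/
theorem exists_parabolic_collapse {A X : Type u} {ι : Type*} [Group A] [TopologicalSpace X]
    [MulAction A X] {H : ι → Subgroup A} [CompactSpace X] [TopologicalSpace.MetrizableSpace X]
    [Finite ι] [∀ i, Infinite (H i)] (hA : IsConvergenceAction A X)
    (hmal : IsDynamicallyMalnormalFamily X H) (hqc : ∀ i, IsDynamicallyQuasiconvex X (H i)) :
    ∃ (Y : Type u) (_ : TopologicalSpace Y) (_ : MulAction A Y) (p : ι → Y), CompactSpace Y ∧
      TopologicalSpace.MetrizableSpace Y ∧ IsConvergenceAction A Y ∧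
      (∀ i, IsParabolicPoint A (p i)) ∧ (∀ i, ∀ a ∈ H i, a • p i = p i) ∧
      ((∀ i, H i ≠ ⊤) → 2 < (limitSet X (⊤ : Subgroup A)).encard →
        2 < (limitSet Y (⊤ : Subgroup A)).encard) := by
  have := hA.continuousConstSMul
  obtain ⟨Y, _, _, π, hY, hYm, hYA, hc, hs, hf, hπ⟩ := exists_collapse hA hmal hqc
  have hne : ∀ i, (limitSet X (H i)).Nonempty := fun i => limitSet_nonempty hA (H i)
  choose c hci using hne
  exact ⟨Y, _, _, fun i => π (c i), hY, hYm, hYA,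
    fun i => isParabolicPoint_of_collapse hA hmal hc hs hf hπ (hci i),
    fun i a ha => (smul_apply_eq_iff_mem hmal hf hπ (hci i) a).2 ha,
    fun htop h2 => two_lt_encard_limitSet_of_collapse hA hmal hc hs hf hπ (fun i => ⟨c i, hci i⟩)
      htop h2⟩

/-! ## A ping-pong action of Serre's group -/

/-- Let `K` be a group embedded in a countable group `Γ`. The set `Γ × J × ℕ` splits as a union of
two free `K`-sets with infinitely many orbits, one of them the part of `K × {i} × ℕ`. -/
theorem exists_equiv_prod_bool {K Γ J : Type*} [Group K] [Group Γ] [Countable Γ] [Countable J]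
    {m : K →* Γ} (hm : Function.Injective m) {i o : J} (hio : o ≠ i) :
    ∃ θ : Γ × J × ℕ ≃ K × Bool × ℕ,
      (∀ k g x, θ (m k * g, x) = (k * (θ (g, x)).1, (θ (g, x)).2)) ∧
      ∀ s, (θ s).2.1 = true ↔ s.1 ∈ m.range ∧ s.2.1 = i := by
  classical
  let R := Quotient (QuotientGroup.rightRel m.range)
  have hR : ∀ g h : Γ, (Quotient.mk _ g : R) = Quotient.mk _ h ↔ h * g⁻¹ ∈ m.range := fun g h => by
    rw [Quotient.eq]
    exact QuotientGroup.rightRel_apply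
  have hRm : ∀ k g, (Quotient.mk _ (m k * g) : R) = Quotient.mk _ g := fun k g => by
    rw [hR]
    exact ⟨k⁻¹, by simp⟩
  let e₁ : K × R ≃ Γ := Equiv.ofBijective (fun x => m x.1 * x.2.out) <| by
    constructor
    · rintro ⟨k, q⟩ ⟨k', q'⟩ h
      have h1 := congrArg (Quotient.mk _ : Γ → R) h
      simp only [hRm, Quotient.out_eq] at h1
      subst h1
      have h2 : m k = m k' := mul_right_cancel h
      rw [hm h2]
    · intro g
      have h1 : (Quotient.mk _ (Quotient.mk _ g : R).out : R) = Quotient.mk _ g := Quotient.out_eq _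
      rw [hR] at h1
      obtain ⟨k, hk⟩ := h1
      exact ⟨(k, Quotient.mk _ g), by simp [hk]⟩
  have he₁a : ∀ x, e₁ x = m x.1 * x.2.out := fun _ => rfl
  have he₁ : ∀ k g, e₁.symm (m k * g) = (k * (e₁.symm g).1, (e₁.symm g).2) := fun k g => by
    obtain ⟨x, rfl⟩ := e₁.surjective g
    rw [Equiv.symm_apply_apply, Equiv.symm_apply_eq]
    simp only [he₁a, map_mul, mul_assoc]
  have he₁' : ∀ g, (e₁.symm g).2 = Quotient.mk _ 1 ↔ g ∈ m.range := fun g => by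
    obtain ⟨⟨k, q⟩, rfl⟩ := e₁.surjective g
    rw [Equiv.symm_apply_apply, he₁a]
    have : q = Quotient.mk _ q.out := (Quotient.out_eq q).symm
    rw [Subgroup.mul_mem_cancel_left _ (MonoidHom.mem_range.2 ⟨k, rfl⟩)]
    dsimp only
    rw [this, hR, one_mul,
      Quotient.out_eq, Subgroup.inv_mem_iff]
  let B : Set (R × J × ℕ) := {x | x.1 = Quotient.mk _ 1 ∧ x.2.1 = i}
  have hB : Infinite B := Infinite.of_injective (fun n : ℕ =>
    (⟨(Quotient.mk _ 1, i, n), rfl, rfl⟩ : B)) fun a b h => by simpa using h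
  -- The second index `o` keeps the complement infinite even when `m` is onto.
  have hB' : Infinite ↑Bᶜ := Infinite.of_injective (fun n : ℕ =>
    (⟨(Quotient.mk _ 1, o, n), fun h => hio h.2⟩ : ↑Bᶜ)) fun a b h => by simpa using h
  have hc : Countable R := inferInstance
  obtain ⟨e₂⟩ := nonempty_equiv_of_countable (α := B) (β := ℕ)
  obtain ⟨e₃⟩ := nonempty_equiv_of_countable (α := ↑Bᶜ) (β := ℕ)
  let e₄ : R × J × ℕ ≃ Bool × ℕ :=
    (Equiv.Set.sumCompl B).symm.trans <| (Equiv.sumComm _ _).trans <| (Equiv.sumCongr e₃ e₂).trans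
      (Equiv.boolProdEquivSum ℕ).symm
  have he₄ : ∀ x, (e₄ x).1 = true ↔ x ∈ B := fun x => by
    by_cases hx : x ∈ B
    · simp [e₄, hx, Equiv.Set.sumCompl_symm_apply_of_mem hx]
    · simp [e₄, hx, Equiv.Set.sumCompl_symm_apply_of_notMem hx]
  refine ⟨(Equiv.prodCongrLeft fun _ => e₁.symm).trans <|
    (Equiv.prodAssoc _ _ _).trans (Equiv.prodCongrRight fun _ => e₄), fun k g x => ?_, fun s => ?_⟩
  · simp [he₁]
  · simp [he₄, B, he₁']

namespace GraphOfGroups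

variable {V E : Type u} (𝒢 : GraphOfGroups V E)

/-- The inclusion of a vertex group in Serre's group. -/
def vertexHom (v : V) : 𝒢.vertexGroup v →* 𝒢.WordGroup :=
  (QuotientGroup.mk' _).comp (Monoid.Coprod.inl.comp Monoid.CoprodI.of)

/-- The vertex at the other end of an edge. -/
def EdgeEnd.opp {𝒢 : GraphOfGroups V E} : ∀ {v : V}, 𝒢.EdgeEnd v → V
  | _, .atSrc e => 𝒢.tgt e
  | _, .atTgt e => 𝒢.src e

/-- The other end of an edge. -/
def EdgeEnd.rev {𝒢 : GraphOfGroups V E} : ∀ {v : V} (i : 𝒢.EdgeEnd v), 𝒢.EdgeEnd i.opp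
  | _, .atSrc e => .atTgt e
  | _, .atTgt e => .atSrc e

/-- The element of Serre's group of an edge, traversed from the given end. -/
def letter : ∀ {v : V}, 𝒢.EdgeEnd v → 𝒢.WordGroup
  | _, .atSrc e => QuotientGroup.mk (𝒢.preEdge e)
  | _, .atTgt e => (QuotientGroup.mk (𝒢.preEdge e))⁻¹

theorem letter_rev {v : V} (i : 𝒢.EdgeEnd v) : 𝒢.letter i.rev = (𝒢.letter i)⁻¹ := by
  cases i
  · rfl
  · exact (inv_inv _).symm

theorem isPathElement_vertexHom {v : V} (g : 𝒢.vertexGroup v) :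
    𝒢.IsPathElement v v (𝒢.vertexHom v g) :=
  .vertex v g

theorem mk_preEdge_mul (e : E) (a : 𝒢.edgeGroup e) :
    (QuotientGroup.mk (𝒢.preEdge e) : 𝒢.WordGroup) * 𝒢.vertexHom _ (𝒢.tgtMap e a) *
      (QuotientGroup.mk (𝒢.preEdge e))⁻¹ = 𝒢.vertexHom _ (𝒢.srcMap e a) := by
  have h : (QuotientGroup.mk (𝒢.preEdge e * 𝒢.preVertex (𝒢.tgtMap e a) * (𝒢.preEdge e)⁻¹ *
      (𝒢.preVertex (𝒢.srcMap e a))⁻¹) : 𝒢.WordGroup) = 1 :=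
    (QuotientGroup.eq_one_iff _).2 (Subgroup.subset_normalClosure ⟨e, a, rfl⟩)
  exact mul_inv_eq_one.1 h

theorem exists_letter_conj {v : V} (i : 𝒢.EdgeEnd v) {g : 𝒢.vertexGroup v}
    (hg : g ∈ 𝒢.edgeSubgroup i) : ∃ k ∈ 𝒢.edgeSubgroup i.rev,
      (𝒢.letter i)⁻¹ * 𝒢.vertexHom v g * 𝒢.letter i = 𝒢.vertexHom i.opp k := by
  cases i with
  | atSrc e =>
    obtain ⟨a, rfl⟩ := hg
    refine ⟨𝒢.tgtMap e a, ⟨a, rfl⟩, ?_⟩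
    simp only [← mk_preEdge_mul, letter, EdgeEnd.opp]
    group
    rfl
  | atTgt e =>
    obtain ⟨a, rfl⟩ := hg
    refine ⟨𝒢.srcMap e a, ⟨a, rfl⟩, ?_⟩
    simp only [letter, inv_inv]
    exact 𝒢.mk_preEdge_mul e a

theorem countable_wordGroup [Countable V] [Countable E] [∀ v, Countable (𝒢.vertexGroup v)] :
    Countable 𝒢.WordGroup := by
  let f : FreeGroup ((Σ v, 𝒢.vertexGroup v) ⊕ E) →* 𝒢.PreWordGroup :=
    FreeGroup.lift (Sum.elim (fun g => 𝒢.preVertex g.2) 𝒢.preEdge)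
  have hv : ∀ {v} (g : 𝒢.vertexGroup v), 𝒢.preVertex g ∈ f.range := fun {v} g =>
    ⟨FreeGroup.of (.inl ⟨v, g⟩), by simp [f]⟩
  have he : ∀ e, 𝒢.preEdge e ∈ f.range := fun e => ⟨FreeGroup.of (.inr e), by simp [f]⟩
  have hf : Function.Surjective f := by
    rw [← MonoidHom.range_eq_top, Subgroup.eq_top_iff']
    intro x
    induction x using Monoid.Coprod.induction_on with
    | inl x =>
      induction x using Monoid.CoprodI.induction_on with
      | one =>
        rw [map_one]
        exact f.range.one_mem
      | of v g => exact hv g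
      | mul x y hx hy =>
        rw [map_mul]
        exact mul_mem hx hy
    | inr x =>
      induction x using FreeGroup.induction_on with
      | C1 =>
        rw [map_one]
        exact f.range.one_mem
      | of e => exact he e
      | inv_of e h =>
        rw [map_inv]
        exact inv_mem h
      | mul x y hx hy =>
        rw [map_mul]
        exact mul_mem hx hy
    | mul x y hx hy => exact mul_mem hx hy
  exact ((QuotientGroup.mk'_surjective _).comp hf).countable

/-- An end of an edge is determined by the edge and by whether it is the source. -/
def EdgeEnd.code {𝒢 : GraphOfGroups V E} : ∀ {v : V}, 𝒢.EdgeEnd v → E × Bool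
  | _, .atSrc e => (e, true)
  | _, .atTgt e => (e, false)

theorem EdgeEnd.code_injective (v : V) : Function.Injective (EdgeEnd.code (𝒢 := 𝒢) (v := v)) := by
  have key : ∀ {v w : V} (i : 𝒢.EdgeEnd v) (k : 𝒢.EdgeEnd w), i.code = k.code → HEq i k := by
    rintro _ _ (e | e) (e' | e') h
    · obtain rfl : e = e' := congrArg Prod.fst h
      rfl
    · exact (Bool.false_ne_true (congrArg Prod.snd h).symm).elim
    · exact (Bool.false_ne_true (congrArg Prod.snd h)).elim
    · obtain rfl : e = e' := congrArg Prod.fst h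
      rfl
  exact fun i k h => eq_of_heq (key i k h)

instance [Countable E] (v : V) : Countable (𝒢.EdgeEnd v) :=
  (EdgeEnd.code_injective 𝒢 v).countable

instance [Finite E] (v : V) : Finite (𝒢.EdgeEnd v) :=
  Finite.of_injective _ (EdgeEnd.code_injective 𝒢 v)

/-- An action of Serre's group with a domain for each edge end, such that the translates by the
vertex group of the domains at a vertex are disjoint and do not cover, and the letter of an edge
exchanges the domain at one end with the complement of the domain at the other end. -/
structure PingPong (S : Type*) [MulAction 𝒢.WordGroup S] where
  dom : ∀ {v : V}, 𝒢.EdgeEnd v → Set S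
  base : V → Set S
  letter_smul_dom_rev : ∀ {v : V} (i : 𝒢.EdgeEnd v), 𝒢.letter i • dom i.rev = (dom i)ᶜ
  eq_and_mem : ∀ {v : V} (i k : 𝒢.EdgeEnd v) (g : 𝒢.vertexGroup v) (s : S), s ∈ dom k →
    s ∈ 𝒢.vertexHom v g • dom i → i = k ∧ g ∈ 𝒢.edgeSubgroup i
  smul_dom : ∀ {v : V} (i : 𝒢.EdgeEnd v), ∀ g ∈ 𝒢.edgeSubgroup i, ∀ s ∈ dom i,
    𝒢.vertexHom v g • s ∈ dom i
  base_nonempty : ∀ v, (base v).Nonempty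
  smul_base : ∀ {v : V} (g : 𝒢.vertexGroup v) (s : S), s ∈ base v → 𝒢.vertexHom v g • s ∈ base v
  notMem_dom : ∀ {v : V} (i : 𝒢.EdgeEnd v) (s : S), s ∈ base v → s ∉ dom i
  vertexHom_injective : ∀ v, Function.Injective (𝒢.vertexHom v)

/-- Each vertex group acts freely on its own copy of `ℕ`, the domain of an end `i` being the edge
group times `{i} × ℕ`. A domain and its complement are both free sets with infinitely many orbits
under the edge group, so an equivariant bijection can exchange them; it serves as the edge letter.
The index `none` supplies base points outside all domains. -/
theorem exists_pingPong [Countable E] [∀ v, Countable (𝒢.vertexGroup v)] :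
    ∃ _ : MulAction 𝒢.WordGroup ℕ, Nonempty (𝒢.PingPong ℕ) := by
  classical
  let S : V → Type u := fun v => 𝒢.vertexGroup v × Option (𝒢.EdgeEnd v) × ℕ
  have hS : ∀ v, Nonempty (S v ≃ ℕ) := fun v => by
    have : Infinite (S v) := inferInstance
    exact nonempty_equiv_of_countable
  let τ := fun v => (hS v).some
  let L : ∀ v, 𝒢.vertexGroup v → Equiv.Perm (S v) := fun v g =>
    Equiv.prodCongr (Equiv.mulLeft g) (Equiv.refl _)
  have hL : ∀ v g s, L v g s = (g * s.1, s.2) := fun _ _ _ => rfl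
  let act : ∀ v, 𝒢.vertexGroup v →* Equiv.Perm ℕ := fun v =>
    { toFun := fun g => (τ v).permCongr (L v g)
      map_one' := by
        ext n
        rw [Equiv.permCongr_apply, hL, one_mul]
        exact (τ v).apply_symm_apply n
      map_mul' := fun g h => by
        ext n
        rw [Equiv.Perm.mul_apply, Equiv.permCongr_apply, Equiv.permCongr_apply,
          Equiv.permCongr_apply, Equiv.symm_apply_apply, hL, hL, hL, mul_assoc] }
  have hsrc := fun e => exists_equiv_prod_bool (J := Option (𝒢.EdgeEnd (𝒢.src e)))
    (𝒢.srcMap_injective e) (i := some (.atSrc e)) (o := none) (by simp)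
  have htgt := fun e => exists_equiv_prod_bool (J := Option (𝒢.EdgeEnd (𝒢.tgt e)))
    (𝒢.tgtMap_injective e) (i := some (.atTgt e)) (o := none) (by simp)
  choose θ hθ hθ' using hsrc
  choose ψ hψ hψ' using htgt
  let flip : ∀ e, 𝒢.edgeGroup e × Bool × ℕ ≃ 𝒢.edgeGroup e × Bool × ℕ := fun e =>
    Equiv.prodCongrRight fun _ => Equiv.prodCongrLeft fun _ => Equiv.boolNot
  let t : E → Equiv.Perm ℕ := fun e =>
    (τ _).symm.trans <| (ψ e).trans <| (flip e).trans <| (θ e).symm.trans (τ _)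
  have hact : ∀ v (g : 𝒢.vertexGroup v) n,
      (τ v).symm (act v g n) = (g * ((τ v).symm n).1, ((τ v).symm n).2) := fun v g n => by
    change (τ v).symm ((τ v).permCongr (L v g) n) = _
    rw [Equiv.permCongr_apply, Equiv.symm_apply_apply, hL]
  have ht : ∀ e n, θ e ((τ _).symm (t e n)) = flip e (ψ e ((τ _).symm n)) := fun e n => by
    simp [t]
  let Φ : 𝒢.PreWordGroup →* Equiv.Perm ℕ :=
    Monoid.Coprod.lift (Monoid.CoprodI.lift act) (FreeGroup.lift t)
  have hΦv : ∀ {v} (g : 𝒢.vertexGroup v), Φ (𝒢.preVertex g) = act v g := fun g => by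
    simp [Φ, preVertex]
  have hΦe : ∀ e, Φ (𝒢.preEdge e) = t e := fun e => by
    simp [Φ, preEdge]
  have hrel : ∀ e a, t e * act _ (𝒢.tgtMap e a) = act _ (𝒢.srcMap e a) * t e := fun e a => by
    ext n
    apply (τ _).symm.injective
    apply (θ e).injective
    rw [Equiv.Perm.mul_apply, Equiv.Perm.mul_apply, ht, hact, hact, hθ, hψ, ht]
    rfl
  have hker : Subgroup.normalClosure 𝒢.relators ≤ Φ.ker := by
    refine Subgroup.normalClosure_le_normal ?_
    rintro _ ⟨e, a, rfl⟩
    change Φ _ = 1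
    rw [map_mul, map_mul, map_mul, map_inv, map_inv, hΦv, hΦv, hΦe, hrel]
    group
  let Ψ : 𝒢.WordGroup →* Equiv.Perm ℕ := QuotientGroup.lift _ Φ hker
  have hΨv : ∀ {v} (g : 𝒢.vertexGroup v), Ψ (𝒢.vertexHom v g) = act v g := fun g => hΦv g
  have hΨe : ∀ e, Ψ (QuotientGroup.mk (𝒢.preEdge e)) = t e := fun e => hΦe e
  let _ : MulAction 𝒢.WordGroup ℕ := MulAction.compHom ℕ Ψ
  have hsmul : ∀ (x : 𝒢.WordGroup) (n : ℕ), x • n = Ψ x n := fun _ _ => rfl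
  have hsmulv : ∀ {v} (g : 𝒢.vertexGroup v) n, 𝒢.vertexHom v g • n = act v g n := fun g n => by
    rw [hsmul, hΨv]
  have hsmule : ∀ e n, (QuotientGroup.mk (𝒢.preEdge e) : 𝒢.WordGroup) • n = t e n := fun e n => by
    rw [hsmul, hΨe]
  let dom : ∀ {v : V}, 𝒢.EdgeEnd v → Set ℕ := fun {v} i =>
    {n | ((τ v).symm n).1 ∈ 𝒢.edgeSubgroup i ∧ ((τ v).symm n).2.1 = some i}
  have hdom : ∀ e n, (QuotientGroup.mk (𝒢.preEdge e) : 𝒢.WordGroup) • n ∈ dom (.atSrc e) ↔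
      n ∉ dom (.atTgt e) := fun e n => by
    have h1 := hθ' e ((τ _).symm (t e n))
    have h2 := hψ' e ((τ _).symm n)
    have h3 : (θ e ((τ _).symm (t e n))).2.1 = !(ψ e ((τ _).symm n)).2.1 := by
      rw [ht]
      rfl
    have h4 : t e n ∈ dom (.atSrc e) ↔ (θ e ((τ _).symm (t e n))).2.1 = true := h1.symm
    have h5 : n ∈ dom (.atTgt e) ↔ (ψ e ((τ _).symm n)).2.1 = true := h2.symm
    rw [hsmule, h4, h5, h3]
    simp
  refine ⟨inferInstance, ⟨{
    dom := dom
    base := fun v => {n | ((τ v).symm n).2.1 = none}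
    letter_smul_dom_rev := ?_
    eq_and_mem := ?_
    smul_dom := ?_
    base_nonempty := fun v => ⟨τ v (1, none, 0), by simp⟩
    smul_base := ?_
    notMem_dom := ?_
    vertexHom_injective := ?_ }⟩⟩
  · rintro _ (e | e) <;> ext n
    · rw [Set.mem_smul_set_iff_inv_smul_mem, Set.mem_compl_iff]
      have := hdom e ((QuotientGroup.mk (𝒢.preEdge e) : 𝒢.WordGroup)⁻¹ • n)
      rw [smul_inv_smul] at this
      exact (not_congr this).trans not_not |>.symm
    · rw [Set.mem_smul_set_iff_inv_smul_mem, Set.mem_compl_iff, letter, inv_inv]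
      exact hdom e n
  · intro v i k g n hk hi
    rw [Set.mem_smul_set_iff_inv_smul_mem, ← map_inv, hsmulv] at hi
    simp only [dom, Set.mem_ofPred_eq, hact] at hk hi
    obtain rfl : i = k := Option.some_injective _ (hi.2.symm.trans hk.2)
    refine ⟨rfl, ?_⟩
    have := (𝒢.edgeSubgroup i).mul_mem hk.1 ((𝒢.edgeSubgroup i).inv_mem hi.1)
    simpa using this
  · intro v i g hg n hn
    rw [hsmulv]
    simp only [dom, Set.mem_ofPred_eq, hact] at hn ⊢
    exact ⟨mul_mem hg hn.1, hn.2⟩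
  · intro v g n hn
    rw [hsmulv]
    simp only [Set.mem_ofPred_eq, hact] at hn ⊢
    exact hn
  · intro v i n hn hi
    have := hi.2.symm.trans hn
    exact Option.some_ne_none _ this
  · intro v g h hgh
    have h1 : act v g = act v h := by rw [← hΨv, ← hΨv, hgh]
    have h2 := hact v g (τ v (1, none, 0))
    rw [h1, hact] at h2
    simpa using (congrArg Prod.fst h2).symm

end GraphOfGroups

/-! ### Reduced words and first edges from ping-pong. -/

namespace GraphOfGroups

variable {V E : Type u} {𝒢 : GraphOfGroups V E}

theorem EdgeEnd.rev_opp {v : V} (i : 𝒢.EdgeEnd v) : i.rev.opp = v := by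
  cases i <;> rfl

theorem exists_letter_mul_letter_rev {v : V} (i : 𝒢.EdgeEnd v) {k : 𝒢.vertexGroup i.opp}
    (hk : k ∈ 𝒢.edgeSubgroup i.rev) : ∃ g : 𝒢.vertexGroup v,
      𝒢.letter i * 𝒢.vertexHom _ k * 𝒢.letter i.rev = 𝒢.vertexHom v g := by
  obtain ⟨g, -, h⟩ := 𝒢.exists_letter_conj i.rev hk
  rw [letter_rev, inv_inv, ← letter_rev] at h
  rw [h]
  cases i <;> exact ⟨g, rfl⟩

namespace PingPong

variable {S : Type*} [MulAction 𝒢.WordGroup S] (p : 𝒢.PingPong S)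

theorem letter_smul_mem {v : V} (i : 𝒢.EdgeEnd v) {s : S} (hs : s ∉ p.dom i.rev) :
    𝒢.letter i • s ∈ p.dom i := by
  by_contra h
  have h' : 𝒢.letter i • s ∈ (p.dom i)ᶜ := h
  rw [← p.letter_smul_dom_rev i, Set.smul_mem_smul_set_iff] at h'
  exact hs h'

theorem notMem_smul_dom {v : V} (g : 𝒢.vertexGroup v) (i : 𝒢.EdgeEnd v) {s : S}
    (hs : s ∈ p.base v) : s ∉ 𝒢.vertexHom v g • p.dom i := by
  rw [Set.mem_smul_set_iff_inv_smul_mem, ← map_inv]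
  exact p.notMem_dom i _ (p.smul_base _ _ hs)

theorem eq_and_mem_of_mem_smul {v : V} {g g' : 𝒢.vertexGroup v} {i i' : 𝒢.EdgeEnd v} {s : S}
    (hs : s ∈ 𝒢.vertexHom v g • p.dom i) (hs' : s ∈ 𝒢.vertexHom v g' • p.dom i') :
    i = i' ∧ g'⁻¹ * g ∈ 𝒢.edgeSubgroup i := by
  rw [Set.mem_smul_set_iff_inv_smul_mem] at hs hs'
  refine p.eq_and_mem i i' (g'⁻¹ * g) ((𝒢.vertexHom v g')⁻¹ • s) hs' ?_
  rw [Set.mem_smul_set_iff_inv_smul_mem]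
  simpa [mul_smul] using hs

/-- The products `g t₁ g₁ ⋯ tₙ gₙ` along reduced paths from `v` that start with `g` and the edge end
`i`, together with the domain that they do not map into the first domain. -/
inductive IsReduced {v : V} (g : 𝒢.vertexGroup v) (i : 𝒢.EdgeEnd v) : V → 𝒢.WordGroup → Set S → Prop
  | single (k : 𝒢.vertexGroup i.opp) :
      IsReduced g i i.opp (𝒢.vertexHom v g * 𝒢.letter i * 𝒢.vertexHom _ k)
        (𝒢.vertexHom _ k⁻¹ • p.dom i.rev)
  | cons {b : V} {x : 𝒢.WordGroup} {L : Set S} (h : IsReduced g i b x L) (i' : 𝒢.EdgeEnd b)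
      (hd : Disjoint (p.dom i') L) (k : 𝒢.vertexGroup i'.opp) :
      IsReduced g i i'.opp (x * 𝒢.letter i' * 𝒢.vertexHom _ k) (𝒢.vertexHom _ k⁻¹ • p.dom i'.rev)

namespace IsReduced

variable {p} {v b : V} {g : 𝒢.vertexGroup v} {i : 𝒢.EdgeEnd v} {x : 𝒢.WordGroup} {L : Set S}

theorem exists_mul_vertexHom (h : p.IsReduced g i b x L) (k : 𝒢.vertexGroup b) :
    ∃ L', p.IsReduced g i b (x * 𝒢.vertexHom b k) L' := by
  cases h with
  | single k' =>
    rw [mul_assoc, ← map_mul]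
    exact ⟨_, .single _⟩
  | cons h i' hd k' =>
    rw [mul_assoc, ← map_mul]
    exact ⟨_, .cons h i' hd _⟩

theorem exists_eq_smul_dom (h : p.IsReduced g i b x L) :
    ∃ (k : 𝒢.vertexGroup b) (i' : 𝒢.EdgeEnd b), L = 𝒢.vertexHom b k • p.dom i' := by
  cases h with
  | single k' => exact ⟨_, _, rfl⟩
  | cons h i' hd k' => exact ⟨_, _, rfl⟩

/-- Ping-pong along the word: each letter sends the complement of the reverse domain into its own
domain, which reducedness keeps off the set forbidden to the preceding part. -/
theorem smul_mem (h : p.IsReduced g i b x L) {s : S} (hs : s ∉ L) :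
    x • s ∈ 𝒢.vertexHom v g • p.dom i := by
  induction h generalizing s with
  | single k =>
    rw [Set.mem_smul_set_iff_inv_smul_mem, map_inv, inv_inv] at hs
    rw [mul_smul, mul_smul]
    exact Set.smul_mem_smul_set (p.letter_smul_mem i hs)
  | cons h i' hd k ih =>
    rw [Set.mem_smul_set_iff_inv_smul_mem, map_inv, inv_inv] at hs
    rw [mul_smul, mul_smul]
    exact ih fun hL => hd.ne_of_mem (p.letter_smul_mem i' hs) hL rfl

/-- If the new domain meets `L`, the new letter backtracks along the last edge through an element of
the edge group. The two letters cancel into a vertex group, leaving a shorter reduced word or a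
vertex element. -/
theorem mul_letter (h : p.IsReduced g i b x L) (i' : 𝒢.EdgeEnd b) :
    (∃ L', p.IsReduced g i i'.opp (x * 𝒢.letter i') L') ∨
      (i'.opp = v ∧ x * 𝒢.letter i' ∈ (𝒢.vertexHom v).range) := by
  by_cases hd : Disjoint (p.dom i') L
  · left
    have := IsReduced.cons h i' hd 1
    rw [map_one, mul_one] at this
    exact ⟨_, this⟩
  · obtain ⟨s, hs, hsL⟩ := Set.not_disjoint_iff.1 hd
    cases h with
    | single k =>
      obtain ⟨rfl, hk⟩ := p.eq_and_mem _ _ _ _ hs hsL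
      obtain ⟨k', hk'⟩ := exists_letter_mul_letter_rev i ((Subgroup.inv_mem_iff _).1 hk)
      refine .inr ⟨i.rev_opp, g * k', ?_⟩
      rw [map_mul, ← hk']
      simp only [mul_assoc]
    | cons h i₂ hd₂ k =>
      obtain ⟨rfl, hk⟩ := p.eq_and_mem _ _ _ _ hs hsL
      obtain ⟨k', hk'⟩ := exists_letter_mul_letter_rev i₂ ((Subgroup.inv_mem_iff _).1 hk)
      obtain ⟨L', hL'⟩ := h.exists_mul_vertexHom k'
      refine .inl ⟨L', ?_⟩
      rw [i₂.rev_opp]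
      rw [← hk'] at hL'
      simpa only [mul_assoc] using hL'

end IsReduced

theorem mem_range_or_isReduced_mul {b c : V} {z : 𝒢.WordGroup} (hz : 𝒢.IsPathElement b c z) {v : V}
    {x : 𝒢.WordGroup} (hx : (b = v ∧ x ∈ (𝒢.vertexHom v).range) ∨
      ∃ (g : 𝒢.vertexGroup v) (i : 𝒢.EdgeEnd v) (L : Set S), p.IsReduced g i b x L) :
    (c = v ∧ x * z ∈ (𝒢.vertexHom v).range) ∨
      ∃ (g : 𝒢.vertexGroup v) (i : 𝒢.EdgeEnd v) (L : Set S), p.IsReduced g i c (x * z) L := by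
  have hletter : ∀ {b : V} (i' : 𝒢.EdgeEnd b) {x : 𝒢.WordGroup},
      ((b = v ∧ x ∈ (𝒢.vertexHom v).range) ∨
        ∃ (g : 𝒢.vertexGroup v) (i : 𝒢.EdgeEnd v) (L : Set S), p.IsReduced g i b x L) →
      (i'.opp = v ∧ x * 𝒢.letter i' ∈ (𝒢.vertexHom v).range) ∨
        ∃ (g : 𝒢.vertexGroup v) (i : 𝒢.EdgeEnd v) (L : Set S),
          p.IsReduced g i i'.opp (x * 𝒢.letter i') L := by
    rintro b i' x (⟨rfl, g, rfl⟩ | ⟨g, i, L, h⟩)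
    · have := IsReduced.single (p := p) (g := g) (i := i') 1
      rw [map_one, mul_one] at this
      exact .inr ⟨g, i', _, this⟩
    · rcases h.mul_letter i' with ⟨L', h'⟩ | h'
      · exact .inr ⟨g, i, L', h'⟩
      · exact .inl h'
  induction hz generalizing x with
  | vertex b k =>
    rcases hx with ⟨rfl, hx⟩ | ⟨g, i, L, h⟩
    · exact .inl ⟨rfl, mul_mem hx ⟨k, rfl⟩⟩
    · obtain ⟨L', h'⟩ := h.exists_mul_vertexHom k
      exact .inr ⟨g, i, L', h'⟩
  | edge e => exact hletter (.atSrc e) hx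
  | edgeInv e => exact hletter (.atTgt e) hx
  | mul _ _ h₁ h₂ =>
    rw [← mul_assoc]
    exact h₂ (h₁ hx)

theorem exists_isReduced {v b : V} {x : 𝒢.WordGroup} (hx : 𝒢.IsPathElement v b x)
    (hx' : x ∉ (𝒢.vertexHom v).range) :
    ∃ (g : 𝒢.vertexGroup v) (i : 𝒢.EdgeEnd v) (L : Set S), p.IsReduced g i b x L := by
  have := p.mem_range_or_isReduced_mul hx (v := v) (x := 1) (.inl ⟨rfl, one_mem _⟩)
  rw [one_mul] at this
  exact this.resolve_left fun h => hx' h.2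

/-- The path from `v` to the translate by `x` of the vertex `b` starts with the edge `g • i`. -/
def StartsWith {v : V} (g : 𝒢.vertexGroup v) (i : 𝒢.EdgeEnd v) (b : V) (x : 𝒢.WordGroup) : Prop :=
  ∀ s ∈ p.base b, x • s ∈ 𝒢.vertexHom v g • p.dom i

variable {p} in
theorem IsReduced.startsWith {v b : V} {g : 𝒢.vertexGroup v} {i : 𝒢.EdgeEnd v} {x : 𝒢.WordGroup}
    {L : Set S} (h : p.IsReduced g i b x L) : p.StartsWith g i b x := by
  obtain ⟨k, i', rfl⟩ := h.exists_eq_smul_dom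
  exact fun s hs => h.smul_mem (p.notMem_smul_dom k i' hs)

variable {p} in
-- As `x` sends the complement of `L` into `g • dom i`, its inverse sends everything outside `g •
-- dom i` into `L`, itself a translate of a domain: the last edge of the path, seen from its end.
theorem IsReduced.exists_startsWith_inv {v b : V} {g : 𝒢.vertexGroup v} {i : 𝒢.EdgeEnd v}
    {x : 𝒢.WordGroup} {L : Set S} (h : p.IsReduced g i b x L) :
    ∃ (k : 𝒢.vertexGroup b) (i' : 𝒢.EdgeEnd b), ∀ (c : V) (y : 𝒢.WordGroup),
      (∀ s ∈ p.base c, y • s ∉ 𝒢.vertexHom v g • p.dom i) → p.StartsWith k i' c (x⁻¹ * y) := by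
  obtain ⟨k, i', rfl⟩ := h.exists_eq_smul_dom
  refine ⟨k, i', fun c y hy s hs => ?_⟩
  by_contra hcon
  have := h.smul_mem hcon
  rw [mul_smul, smul_inv_smul] at this
  exact hy s hs this

namespace StartsWith

variable {p} {v b : V} {g g' : 𝒢.vertexGroup v} {i i' : 𝒢.EdgeEnd v} {x : 𝒢.WordGroup}

theorem eq_and_mem (h : p.StartsWith g i b x) (h' : p.StartsWith g' i' b x) :
    i = i' ∧ g'⁻¹ * g ∈ 𝒢.edgeSubgroup i := by
  obtain ⟨s, hs⟩ := p.base_nonempty b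
  exact p.eq_and_mem_of_mem_smul (h s hs) (h' s hs)

theorem vertexHom_mul (h : p.StartsWith g i b x) (a : 𝒢.vertexGroup v) :
    p.StartsWith (a * g) i b (𝒢.vertexHom v a * x) := by
  intro s hs
  rw [mul_smul, map_mul, mul_smul]
  exact Set.smul_mem_smul_set (h s hs)

theorem mul_vertexHom (h : p.StartsWith g i b x) (a : 𝒢.vertexGroup b) :
    p.StartsWith g i b (x * 𝒢.vertexHom b a) := by
  intro s hs
  rw [mul_smul]
  exact h _ (p.smul_base a s hs)

theorem congr (h : p.StartsWith g i b x) (hg : g'⁻¹ * g ∈ 𝒢.edgeSubgroup i) :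
    p.StartsWith g' i b x := by
  intro s hs
  have h1 := h s hs
  rw [Set.mem_smul_set_iff_inv_smul_mem] at h1 ⊢
  have h2 := p.smul_dom i _ hg _ h1
  rwa [map_mul, mul_smul, smul_inv_smul, map_inv] at h2

end StartsWith

/-- Two path elements that differ by a fixed path start with the same edge, unless the initial vertex
is one of finitely many vertices. -/
theorem exists_finite_startsWith_mul {b c : V} {z : 𝒢.WordGroup} (hz : 𝒢.IsPathElement b c z) {v : V}
    {x : 𝒢.WordGroup} (hx : 𝒢.IsPathElement v b x) : ∃ T : Set 𝒢.WordGroup, T.Finite ∧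
      ∀ y, 𝒢.IsPathElement v v y → (∀ t ∈ T, y⁻¹ * t ∉ (𝒢.vertexHom v).range) →
        ∀ (g : 𝒢.vertexGroup v) (i : 𝒢.EdgeEnd v), p.StartsWith g i b (y⁻¹ * x) →
          p.StartsWith g i c (y⁻¹ * (x * z)) := by
  have hletter : ∀ {b : V} (i' : 𝒢.EdgeEnd b) {x : 𝒢.WordGroup}, 𝒢.IsPathElement v b x →
      ∃ T : Set 𝒢.WordGroup, T.Finite ∧
      ∀ y, 𝒢.IsPathElement v v y → (∀ t ∈ T, y⁻¹ * t ∉ (𝒢.vertexHom v).range) →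
        ∀ (g : 𝒢.vertexGroup v) (i : 𝒢.EdgeEnd v), p.StartsWith g i b (y⁻¹ * x) →
          p.StartsWith g i i'.opp (y⁻¹ * (x * 𝒢.letter i')) := by
    intro b i' x hx
    -- Appending one edge can change the first edge only if the path starts at an endpoint of that
    -- edge.
    refine ⟨{x, x * 𝒢.letter i'}, Set.toFinite _, fun y hy hT g i h => ?_⟩
    obtain ⟨g', i₂, L, hred⟩ := p.exists_isReduced (hy.inv.mul hx) (hT x (by simp))
    obtain ⟨rfl, hmem⟩ := hred.startsWith.eq_and_mem h
    rcases hred.mul_letter i' with ⟨L', hred'⟩ | ⟨-, hmem'⟩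
    · rw [← mul_assoc]
      exact hred'.startsWith.congr hmem
    · exact absurd (by rwa [mul_assoc] at hmem') (hT (x * 𝒢.letter i') (by simp))
  induction hz generalizing x with
  | vertex b k =>
    refine ⟨∅, Set.finite_empty, fun y _ _ g i h => ?_⟩
    rw [← mul_assoc]
    exact h.mul_vertexHom k
  | edge e => exact hletter (.atSrc e) hx
  | edgeInv e => exact hletter (.atTgt e) hx
  | mul hz₁ _ h₁ h₂ =>
    obtain ⟨T₁, hT₁, h₁⟩ := h₁ hx
    obtain ⟨T₂, hT₂, h₂⟩ := h₂ (hx.mul hz₁)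
    refine ⟨T₁ ∪ T₂, hT₁.union hT₂, fun y hy hT g i h => ?_⟩
    rw [← mul_assoc x]
    exact h₂ y hy (fun t ht => hT t (.inr ht)) g i (h₁ y hy (fun t ht => hT t (.inl ht)) g i h)

end PingPong

/-! ## The projection of a graph of groups -/

/-- The inclusion of a vertex group in the fundamental group at the vertex. -/
def vertexInclusion (𝒢 : GraphOfGroups V E) (v : V) : 𝒢.vertexGroup v →* 𝒢.fundamentalGroup v :=
  (𝒢.vertexHom v).codRestrict _ fun g => 𝒢.isPathElement_vertexHom g

theorem mem_range_vertexInclusion {v : V} {x : 𝒢.fundamentalGroup v} :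
    x ∈ (𝒢.vertexInclusion v).range ↔ (x : 𝒢.WordGroup) ∈ (𝒢.vertexHom v).range :=
  ⟨fun ⟨g, hg⟩ => ⟨g, congrArg Subtype.val hg⟩, fun ⟨g, hg⟩ => ⟨g, Subtype.ext hg⟩⟩

/-- The first edge determines `g` up to the edge group, which fixes `q i`, so `g • q i` is well
defined. Two paths from `v` share their first edge, or else `v` lies between their ends, and then
from the end of one both `v` and the other end lie in the same direction. -/
theorem exists_isCosetProjection {S : Type*} [MulAction 𝒢.WordGroup S] (p : 𝒢.PingPong S) {v : V}
    {Y : Type*} [TopologicalSpace Y] [MulAction (𝒢.vertexGroup v) Y]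
    [ContinuousConstSMul (𝒢.vertexGroup v) Y] [Nonempty Y] {q : 𝒢.EdgeEnd v → Y}
    (hq : ∀ i, IsParabolicPoint (𝒢.vertexGroup v) (q i))
    (hfix : ∀ i, ∀ a ∈ 𝒢.edgeSubgroup i, a • q i = q i) :
    ∃ P : 𝒢.fundamentalGroup v → Y, IsCosetProjection (𝒢.vertexInclusion v) P := by
  classical
  obtain ⟨P, hP⟩ : ∃ P : 𝒢.fundamentalGroup v → Y, ∀ x g i, p.StartsWith g i v x.1 →
      P x = g • q i := by
    refine ⟨fun x => if h : ∃ a : 𝒢.vertexGroup v × 𝒢.EdgeEnd v, p.StartsWith a.1 a.2 v x.1 then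
      h.choose.1 • q h.choose.2 else Classical.arbitrary Y, fun x g i h => ?_⟩
    have hex : ∃ a : 𝒢.vertexGroup v × 𝒢.EdgeEnd v, p.StartsWith a.1 a.2 v x.1 := ⟨(g, i), h⟩
    simp only [dif_pos hex]
    obtain ⟨hi, hmem⟩ := hex.choose_spec.eq_and_mem h
    have := hfix _ _ hmem
    rw [mul_smul, inv_smul_eq_iff] at this
    rw [this, hi]
  have hred : ∀ x : 𝒢.fundamentalGroup v, x ∉ (𝒢.vertexInclusion v).range →
      ∃ (g : 𝒢.vertexGroup v) (i : 𝒢.EdgeEnd v) (L : Set S), p.IsReduced g i v x.1 L := fun x hx =>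
    p.exists_isReduced x.2 (mem_range_vertexInclusion.not.1 hx)
  refine ⟨P, ⟨fun a x hx => ?_, fun x a hx => ?_, fun x y hx hy _ => ?_, fun w => ?_, fun x hx => ?_⟩⟩
  · obtain ⟨g, i, L, h⟩ := hred x hx
    rw [hP _ _ _ (h.startsWith.vertexHom_mul a), hP _ _ _ h.startsWith, mul_smul]
  · obtain ⟨g, i, L, h⟩ := hred x hx
    rw [hP _ _ _ (h.startsWith.mul_vertexHom a), hP _ _ _ h.startsWith]
  · obtain ⟨g, i, L, h⟩ := hred x hx
    obtain ⟨g', i', L', h'⟩ := hred y hy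
    by_cases hmeet : ∃ s, s ∈ 𝒢.vertexHom v g • p.dom i ∧ s ∈ 𝒢.vertexHom v g' • p.dom i'
    · left
      obtain ⟨s, hs, hs'⟩ := hmeet
      obtain ⟨rfl, hmem⟩ := p.eq_and_mem_of_mem_smul hs hs'
      have := hfix _ _ hmem
      rw [mul_smul, inv_smul_eq_iff] at this
      rw [hP _ _ _ h.startsWith, hP _ _ _ h'.startsWith, this]
    · right
      push Not at hmeet
      obtain ⟨k, l, hkl⟩ := h.exists_startsWith_inv
      have h1 := hkl v 1 fun s hs => by
        rw [one_smul]
        exact p.notMem_smul_dom g i hs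
      rw [mul_one] at h1
      have h2 := hkl v y.1 fun s hs hmem => hmeet _ hmem (h'.startsWith s hs)
      rw [hP x⁻¹ k l h1, hP (x⁻¹ * y) k l h2]
  · obtain ⟨T, hT, hTw⟩ := p.exists_finite_startsWith_mul w.2 (IsPathElement.one 𝒢 v)
    refine ⟨Subtype.val ⁻¹' T, hT.preimage Subtype.val_injective.injOn, fun y hy _ hne => ?_⟩
    by_contra! hcon
    obtain ⟨g, i, L, h⟩ := hred y⁻¹ (by rwa [Subgroup.inv_mem_iff])
    have h1 : p.StartsWith g i v (y⁻¹ * w).1 := by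
      have := hTw y.1 y.2 (fun t ht hmem => by
        have hpath : t ∈ 𝒢.fundamentalGroup v := by
          have h2 : y.1⁻¹ * t ∈ 𝒢.fundamentalGroup v := by
            obtain ⟨a, ha⟩ := hmem
            rw [← ha]
            exact 𝒢.isPathElement_vertexHom a
          exact (Subgroup.mul_mem_cancel_left _ (inv_mem y.2)).1 h2
        exact hcon ⟨t, hpath⟩ ht (mem_range_vertexInclusion.2 hmem)) g i (by
          rw [mul_one]
          exact h.startsWith)
      rwa [one_mul] at this
    exact hne ((hP _ _ _ h.startsWith).trans (hP _ _ _ h1).symm)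
  · obtain ⟨g, i, L, h⟩ := hred x hx
    rw [hP _ _ _ h.startsWith]
    exact (hq i).smul g

end GraphOfGroups

/-! ## Transport along isomorphisms -/

section Transport

variable {G G' : Type u} [Group G] [Group G'] {M : Type*} [TopologicalSpace M] [MulAction G M]
  [MulAction G' M]

theorem ConvergesAway.transport {e : G →* G'} (he : ∀ (g : G) (x : M), e g • x = g • x)
    {g : ℕ → G} {ξ η : M} (h : ConvergesAway g ξ η) : ConvergesAway (e ∘ g) ξ η := by
  intro K hK hη U hU
  simpa only [Function.comp_apply, he] using h K hK hη U hU

theorem IsConvergenceAction.transport (e : G ≃* G') (he : ∀ (g : G) (x : M), e g • x = g • x)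
    (h : IsConvergenceAction G M) : IsConvergenceAction G' M := by
  refine ⟨fun g => ?_, fun g hg => ?_⟩
  · have := h.continuous_smul (e.symm g)
    simpa only [← he, e.apply_symm_apply] using this
  · obtain ⟨σ, hσ, ξ, η, hlim⟩ := h.exists_subseq (e.symm ∘ g) (e.symm.injective.comp hg)
    refine ⟨σ, hσ, ξ, η, ?_⟩
    have := hlim.transport (e := e.toMonoidHom) he
    simpa [Function.comp_def] using this

theorem limitSet_top_subset_of_mulEquiv (e : G ≃* G') (he : ∀ (g : G) (x : M), e g • x = g • x) :
    limitSet M (⊤ : Subgroup G) ⊆ limitSet M (⊤ : Subgroup G') := by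
  rintro ξ ⟨g, hg, -, η, h⟩
  exact ⟨e ∘ g, e.injective.comp hg, fun _ => Subgroup.mem_top _, η,
    h.transport (e := e.toMonoidHom) he⟩

theorem IsNonelementaryAction.transport (e : G ≃* G') (he : ∀ (g : G) (x : M), e g • x = g • x)
    (h : IsNonelementaryAction G M) : IsNonelementaryAction G' M :=
  ⟨h.1.transport e he,
    h.2.trans_le (Set.encard_le_encard (limitSet_top_subset_of_mulEquiv e he))⟩

theorem IsConvergenceGroup.of_mulEquiv (e : G ≃* G') (h : IsConvergenceGroup G) :
    IsConvergenceGroup G' := by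
  obtain ⟨M, _, _, hM, hM', h⟩ := h
  let _ : MulAction G' M := MulAction.compHom M e.symm.toMonoidHom
  exact ⟨M, _, inferInstance, hM, hM', h.transport e fun g x =>
    congrArg (· • x) (e.symm_apply_apply g)⟩

theorem IsNonelementaryConvergenceGroup.of_mulEquiv (e : G ≃* G')
    (h : IsNonelementaryConvergenceGroup G) : IsNonelementaryConvergenceGroup G' := by
  obtain ⟨M, _, _, hM, hM', h⟩ := h
  let _ : MulAction G' M := MulAction.compHom M e.symm.toMonoidHom
  exact ⟨M, _, inferInstance, hM, hM', h.transport e fun g x =>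
    congrArg (· • x) (e.symm_apply_apply g)⟩

end Transport

/-! ## The combination theorem -/

namespace GraphOfGroups

variable {V E : Type u} {𝒢 : GraphOfGroups V E}

theorem Connected.exists_isPathElement (hconn : 𝒢.Connected) (v w : V) :
    ∃ x, 𝒢.IsPathElement v w x := by
  induction hconn.2 v w with
  | refl => exact ⟨1, .one 𝒢 v⟩
  | tail _ h ih =>
    obtain ⟨x, hx⟩ := ih
    obtain ⟨e, ⟨rfl, rfl⟩ | ⟨rfl, rfl⟩⟩ := h
    · exact ⟨_, hx.mul (.edge e)⟩
    · exact ⟨_, hx.mul (.edgeInv e)⟩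

/-- A path between two vertices conjugates the fundamental groups at them. -/
theorem IsPathElement.nonempty_mulEquiv {v w : V} {x : 𝒢.WordGroup} (hx : 𝒢.IsPathElement v w x) :
    Nonempty (𝒢.fundamentalGroup w ≃* 𝒢.fundamentalGroup v) :=
  ⟨{ toFun := fun y => ⟨x * y * x⁻¹, (hx.mul y.2).mul hx.inv⟩
     invFun := fun y => ⟨x⁻¹ * y * x, (hx.inv.mul y.2).mul hx⟩
     left_inv := fun y => Subtype.ext (by simp [mul_assoc])
     right_inv := fun y => Subtype.ext (by simp [mul_assoc])
     map_mul' := fun y z => Subtype.ext (by simp [mul_assoc]) }⟩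

theorem isConvergenceGroup_fundamentalGroup [Finite V] [Finite E]
    [∀ v, Countable (𝒢.vertexGroup v)] [∀ e, Infinite (𝒢.edgeGroup e)]
    (X : V → Type u) [∀ v, TopologicalSpace (X v)] [∀ v, MulAction (𝒢.vertexGroup v) (X v)] (v : V)
    [CompactSpace (X v)] [TopologicalSpace.MetrizableSpace (X v)]
    (hconv : IsConvergenceAction (𝒢.vertexGroup v) (X v))
    (hqc : ∀ i : 𝒢.EdgeEnd v, IsDynamicallyQuasiconvex (X v) (𝒢.limitSetStabilizer X i))
    (hmal : IsDynamicallyMalnormalFamily (X v)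
      (fun i : 𝒢.EdgeEnd v => 𝒢.limitSetStabilizer X i)) :
    IsConvergenceGroup (𝒢.fundamentalGroup v) ∧
      (IsNonelementaryAction (𝒢.vertexGroup v) (X v) →
        (∀ i : 𝒢.EdgeEnd v, 𝒢.limitSetStabilizer X i ≠ ⊤) →
          IsNonelementaryConvergenceGroup (𝒢.fundamentalGroup v)) := by
  have := 𝒢.countable_wordGroup
  have := hconv.continuousConstSMul
  obtain ⟨_, ⟨p⟩⟩ := 𝒢.exists_pingPong
  have hj : Function.Injective (𝒢.vertexInclusion v) := fun g h hgh =>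
    p.vertexHom_injective v (congrArg Subtype.val hgh)
  by_cases hsurj : Function.Surjective (𝒢.vertexInclusion v)
  -- No nontrivial coset exists, so the action on `X v` itself is transported.
  · let e := MulEquiv.ofBijective (𝒢.vertexInclusion v) ⟨hj, hsurj⟩
    refine ⟨.of_mulEquiv e ⟨X v, inferInstance, inferInstance, inferInstance, inferInstance, hconv⟩,
      fun h _ => .of_mulEquiv e
        ⟨X v, inferInstance, inferInstance, inferInstance, inferInstance, h⟩⟩
  · obtain ⟨g₀, hg₀⟩ : ∃ g₀, g₀ ∉ (𝒢.vertexInclusion v).range := by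
      by_contra! h
      exact hsurj h
    have hedge : ∀ i : 𝒢.EdgeEnd v, Infinite (𝒢.edgeSubgroup i) := by
      rintro (e | e)
      · exact Infinite.of_injective _ (MonoidHom.ofInjective (𝒢.srcMap_injective e)).injective
      · exact Infinite.of_injective _ (MonoidHom.ofInjective (𝒢.tgtMap_injective e)).injective
    have hle : ∀ i : 𝒢.EdgeEnd v, 𝒢.edgeSubgroup i ≤ 𝒢.limitSetStabilizer X i := fun i g hg =>
      MulAction.mem_stabilizer_iff.2 (smul_limitSet_eq hg)
    have hinf : ∀ i : 𝒢.EdgeEnd v, Infinite (𝒢.limitSetStabilizer X i) := fun i =>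
      Infinite.of_injective _ (Subgroup.inclusion_injective (hle i))
    obtain ⟨Y, _, _, q, _, _, hY, hq, hfix, hlim⟩ := exists_parabolic_collapse hconv hmal hqc
    have := hY.continuousConstSMul
    obtain ⟨-, i, -⟩ := p.exists_isReduced g₀.2 (mem_range_vertexInclusion.not.1 hg₀)
    have : Nonempty Y := ⟨q i⟩
    obtain ⟨P, hP⟩ := exists_isCosetProjection p hq fun i a ha => hfix i a (hle i ha)
    obtain ⟨h1, h2⟩ := CombinationSpace.exists_convergenceAction hP hj hY hg₀
    exact ⟨h1, fun h htop => h2 (hlim htop h.2)⟩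

end GraphOfGroups

theorem theorem1p3 {V E : Type u} [Finite V] [Finite E] (𝒢 : GraphOfGroups V E)
    (hconn : 𝒢.Connected)
    (hcount : ∀ v, Countable (𝒢.vertexGroup v))
    (hinf : ∀ e, Infinite (𝒢.edgeGroup e))
    (X : V → Type u) [∀ v, TopologicalSpace (X v)] [∀ v, CompactSpace (X v)]
    [∀ v, TopologicalSpace.MetrizableSpace (X v)]
    [∀ v, MulAction (𝒢.vertexGroup v) (X v)]
    (hconv : ∀ v, IsConvergenceAction (𝒢.vertexGroup v) (X v))
    (hqc : ∀ (v : V) (i : 𝒢.EdgeEnd v),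
      IsDynamicallyQuasiconvex (X v) (𝒢.limitSetStabilizer X i))
    (hmal : ∀ v : V, IsDynamicallyMalnormalFamily (X v)
      (fun i : 𝒢.EdgeEnd v => 𝒢.limitSetStabilizer X i))
    (v₀ : V) :
    IsConvergenceGroup (𝒢.fundamentalGroup v₀) ∧
      ((∃ v : V, IsNonelementaryAction (𝒢.vertexGroup v) (X v) ∧
          ∀ i : 𝒢.EdgeEnd v, 𝒢.limitSetStabilizer X i ≠ ⊤) →
        IsNonelementaryConvergenceGroup (𝒢.fundamentalGroup v₀)) := by
  have : ∀ (w : V), IsConvergenceGroup (𝒢.fundamentalGroup w) ∧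
      (IsNonelementaryAction (𝒢.vertexGroup w) (X w) →
        (∀ i : 𝒢.EdgeEnd w, 𝒢.limitSetStabilizer X i ≠ ⊤) →
          IsNonelementaryConvergenceGroup (𝒢.fundamentalGroup w)) := fun w =>
    𝒢.isConvergenceGroup_fundamentalGroup X w (hconv w) (hqc w) (hmal w)
  refine ⟨(this v₀).1, ?_⟩
  rintro ⟨v, hv, htop⟩
  -- The construction is made at the non-elementary vertex and carried to `v₀` by conjugation along
  -- a path.
  obtain ⟨x, hx⟩ := hconn.exists_isPathElement v₀ v
  obtain ⟨e⟩ := hx.nonempty_mulEquiv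
  exact ((this v).2 hv htop).of_mulEquiv e
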